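/- Let $K$ be a field (for instance $K=\mathbb{Q}$). For a finite set $I$ let $\mathrm{NAP}(I)$ be the set of rooted trees with vertex set $I$; for $t\in\mathrm{NAP}(I)$ and $s_i\in\mathrm{NAP}(J_i)$ the composition $t\circ(s_i)_{i\in I}\in\mathrm{NAP}(\bigsqcup_i J_i)$ is obtained from the disjoint union of the $s_i$ by adding, for each edge $\{i,i'\}$ of $t$, an edge between the roots of $s_i$ and $s_{i'}$; its root is the root of $s_k$, where $k$ is the root of $t$. Let $\Pi_{\mathrm{NAP}}(I)$ be the set of pairs $x=(\pi_x,(x_u)_{u\in\pi_x})$ of a partition $\pi_x$ of $I$ and a tree $x_u\in\mathrm{NAP}(u)$ for each part $u$, partially ordered by: $x\le y$ if and only if $y=\theta\circ x$ for some $\theta\in\Pi_{\mathrm{NAP}}(\pi_x)$, where $\theta\circ x$ replaces each tree $\theta_v$ by $\theta_v\circ(x_u)_{u\in v}$. Its least element is denoted $\widehat 0$. The incidence Hopf algebra $H_{\mathrm{NAP}}$ is the $K$-vector space with basis $\mathsf F_{[P]}$ indexed by the isomorphism classes of finite products $P$ of the intervals $[\widehat 0,t]$ ($t$ a rooted tree),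 with product $\mathsf F_{[P]}\mathsf F_{[Q]}=\mathsf F_{[P\times Q]}$ and coproduct $\Delta(\mathsf F_{[P]})=\sum_{x\in P}\mathsf F_{[\widehat 0,x]}\otimes\mathsf F_{[x,\widehat 1]}$. For a rooted tree $t$ write $\mathsf F_{[t]}=\mathsf F_{[P]}$ with $P=[\widehat 0,t]$. Let $B(r,t_1,\dots,t_k)$ denote the rooted tree obtained by joining a new root $r$ to the roots of $t_1,\dots,t_k$. The Connes–Kreimer Hopf algebra $\mathcal H_R$ is the free commutative $K$-algebra on the unlabelled rooted trees, with the coproduct determined by $\Delta(B^+(x))=B^+(x)\otimes 1+(\mathrm{id}\otimes B^+)(\Delta(x))$, where $B^+:\mathcal H_R\to\mathcal H_R$ is the linear map sending a forest $t_1\cdots t_k$ to the tree $B(r,t_1,\dots,t_k)$. For a commutative Hopf algebra $H$, call a linear map $L:H\to H$ a $1$-cocycle if $\Delta(L(x))=L(x)\otimes 1+(\mathrm{id}\otimes L)(\Delta(x))$ for all $x\in H$. Call such a pair $(H,L)$ universal if for every commutative Hopf algebra $H'$ over $K$ with a $1$-cocycle $L'$ there is a unique morphism of Hopf algebras $\phi:H\to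 H'$ with $\phi\circ L=L'\circ\phi$. **Theorem.** There is a unique linear map $L_{\mathrm{NAP}}:H_{\mathrm{NAP}}\to H_{\mathrm{NAP}}$ with $L_{\mathrm{NAP}}(\mathsf F_{[t]})=\mathsf F_{[B(r,t)]}$ for every rooted tree $t$. Both $L_{\mathrm{NAP}}$ and $B^+$ are $1$-cocycles, and both pairs $(H_{\mathrm{NAP}},L_{\mathrm{NAP}})$ and $(\mathcal H_R,B^+)$ are universal. Consequently $H_{\mathrm{NAP}}$ is isomorphic to $\mathcal H_R$ as a Hopf algebra: there is an isomorphism of Hopf algebras $\varphi:H_{\mathrm{NAP}}\to\mathcal H_R$ with $\varphi\circ L_{\mathrm{NAP}}=B^+\circ\varphi$; it is the only morphism of bialgebras with this property, and $$\varphi\bigl(\mathsf F_{[B(r,t_1,\dots,t_k)]}\bigr)=t_1\cdots t_k$$ for all $k\ge 0$ and all rooted trees $t_1,\dots,t_k$. -/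

import Mathlib

open scoped TensorProduct

namespace Incidence

/-- The direct product of the finite list `l` of members of a collection of posets. -/
def Prd {A : Type} (P : A → Type) : List A → Type
  | [] => PUnit
  | a :: l => P a × Prd P l

section Prd

variable {A : Type} (P : A → Type)

instance instPartialOrderPrd [∀ a, PartialOrder (P a)] : ∀ l : List A, PartialOrder (Prd P l)
  | [] => inferInstanceAs (PartialOrder PUnit)
  | a :: l =>
    letI := instPartialOrderPrd l
    inferInstanceAs (PartialOrder (P a × Prd P l))

instance instBoundedOrderPrd [∀ a, PartialOrder (P a)] [∀ a, BoundedOrder (P a)] :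
    ∀ l : List A, BoundedOrder (Prd P l)
  | [] => inferInstanceAs (BoundedOrder PUnit)
  | a :: l =>
    letI := instBoundedOrderPrd l
    inferInstanceAs (BoundedOrder (P a × Prd P l))

instance instFinitePrd [∀ a, Finite (P a)] : ∀ l : List A, Finite (Prd P l)
  | [] => inferInstanceAs (Finite PUnit)
  | a :: l =>
    have := instFinitePrd l
    inferInstanceAs (Finite (P a × Prd P l))

end Prd

/-- A good collection of finite posets: every member has a least and a greatest element, and the
initial intervals `[0̂, x]` and the final intervals `[x, 1̂]` of the members are isomorphic to
finite products of members. -/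
structure GoodFamily where
  A : Type
  P : A → Type
  [po : ∀ a, PartialOrder (P a)]
  [bo : ∀ a, BoundedOrder (P a)]
  [fin : ∀ a, Finite (P a)]
  initial : ∀ a (x : P a), ∃ l : List A, Nonempty (Set.Iic x ≃o Prd P l)
  final : ∀ a (x : P a), ∃ l : List A, Nonempty (Set.Ici x ≃o Prd P l)

attribute [instance] GoodFamily.po GoodFamily.bo GoodFamily.fin

variable (G : GoodFamily)

noncomputable instance instFintypePrd (l : List G.A) : Fintype (Prd G.P l) := Fintype.ofFinite _

/-- Two finite products of members of the family are equivalent when they are isomorphic as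
posets. -/
instance isoSetoid : Setoid (List G.A) where
  r l l' := Nonempty (Prd G.P l ≃o Prd G.P l')
  iseqv :=
    ⟨fun _ => ⟨OrderIso.refl _⟩, fun ⟨e⟩ => ⟨e.symm⟩, fun ⟨e⟩ ⟨f⟩ => ⟨e.trans f⟩⟩

/-- Isomorphism classes of finite products of members of the family. -/
def Cls : Type := Quotient (isoSetoid G)

/-- The poset `Q` is isomorphic to a finite product of members of the family. -/
class InFam (Q : Type) [PartialOrder Q] : Prop where
  exists_iso : ∃ l : List G.A, Nonempty (Q ≃o Prd G.P l)

/-- The isomorphism class `[Q]`. -/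
noncomputable def cls (Q : Type) [PartialOrder Q] [h : InFam G Q] : Cls G :=
  Quotient.mk (isoSetoid G) h.exists_iso.choose

variable {G}

instance instInFamPrd (l : List G.A) : InFam G (Prd G.P l) := ⟨l, ⟨OrderIso.refl _⟩⟩

theorem cls_eq_mk {Q : Type} [PartialOrder Q] [h : InFam G Q] {l : List G.A}
    (e : Q ≃o Prd G.P l) : cls G Q = Quotient.mk (isoSetoid G) l :=
  Quotient.sound ⟨h.exists_iso.choose_spec.some.symm.trans e⟩

theorem cls_eq {Q R : Type} [PartialOrder Q] [PartialOrder R] [InFam G Q] [h : InFam G R]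
    (e : Q ≃o R) : cls G Q = cls G R := by
  obtain ⟨l, ⟨f⟩⟩ := h.exists_iso
  rw [cls_eq_mk f, cls_eq_mk (e.trans f)]

theorem cls_prd (l : List G.A) : cls G (Prd G.P l) = Quotient.mk (isoSetoid G) l :=
  cls_eq_mk (OrderIso.refl _)

theorem InFam.of_iso {Q R : Type} [PartialOrder Q] [PartialOrder R] [h : InFam G Q]
    (e : R ≃o Q) : InFam G R := by
  obtain ⟨l, ⟨f⟩⟩ := h.exists_iso
  exact ⟨l, ⟨e.trans f⟩⟩

theorem InFam.finite (G : GoodFamily) (Q : Type) [PartialOrder Q] [h : InFam G Q] : Finite Q := by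
  obtain ⟨l, ⟨f⟩⟩ := h.exists_iso
  exact Finite.of_equiv _ f.symm.toEquiv

section OrderIsos

variable {Q R S T : Type} [PartialOrder Q] [PartialOrder R] [PartialOrder S] [PartialOrder T]

def prodCongrIso (e : Q ≃o R) (f : S ≃o T) : Q × S ≃o R × T where
  toEquiv := Equiv.prodCongr e.toEquiv f.toEquiv
  map_rel_iff' {a b} := by
    rcases a with ⟨a, a'⟩
    rcases b with ⟨b, b'⟩
    simp [Prod.mk_le_mk]

def punitProdIso : PUnit.{1} × Q ≃o Q where
  toEquiv := Equiv.punitProd Q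
  map_rel_iff' {a b} := by
    rcases a with ⟨_, a⟩
    rcases b with ⟨_, b⟩
    simp [Prod.mk_le_mk]

def iicCongr (e : Q ≃o R) (x : Q) : Set.Iic x ≃o Set.Iic (e x) where
  toEquiv := e.toEquiv.subtypeEquiv fun a => by simp
  map_rel_iff' {a b} := by
    rcases a with ⟨a, _⟩
    rcases b with ⟨b, _⟩
    simp [Equiv.subtypeEquiv]

def iciCongr (e : Q ≃o R) (x : Q) : Set.Ici x ≃o Set.Ici (e x) where
  toEquiv := e.toEquiv.subtypeEquiv fun a => by simp
  map_rel_iff' {a b} := by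
    rcases a with ⟨a, _⟩
    rcases b with ⟨b, _⟩
    simp [Equiv.subtypeEquiv]

def iicProd (x : Q × R) : Set.Iic x ≃o Set.Iic x.1 × Set.Iic x.2 where
  toFun y := (⟨y.1.1, y.2.1⟩, ⟨y.1.2, y.2.2⟩)
  invFun y := ⟨(y.1.1, y.2.1), ⟨y.1.2, y.2.2⟩⟩
  left_inv _ := rfl
  right_inv _ := rfl
  map_rel_iff' := Iff.rfl

def iciProd (x : Q × R) : Set.Ici x ≃o Set.Ici x.1 × Set.Ici x.2 where
  toFun y := (⟨y.1.1, y.2.1⟩, ⟨y.1.2, y.2.2⟩)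
  invFun y := ⟨(y.1.1, y.2.1), ⟨y.1.2, y.2.2⟩⟩
  left_inv _ := rfl
  right_inv _ := rfl
  map_rel_iff' := Iff.rfl

def iicIic {x : Q} (y : Set.Iic x) : Set.Iic y ≃o Set.Iic y.1 where
  toFun z := ⟨z.1.1, z.2⟩
  invFun z := ⟨⟨z.1, le_trans z.2 y.2⟩, z.2⟩
  left_inv _ := rfl
  right_inv _ := rfl
  map_rel_iff' := Iff.rfl

def iciIci {x : Q} (y : Set.Ici x) : Set.Ici y ≃o Set.Ici y.1 where
  toFun z := ⟨z.1.1, z.2⟩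
  invFun z := ⟨⟨z.1, le_trans y.2 z.2⟩, z.2⟩
  left_inv _ := rfl
  right_inv _ := rfl
  map_rel_iff' := Iff.rfl

def iciIic {x y : Q} (h : y ≤ x) :
    Set.Ici (⟨y, h⟩ : Set.Iic x) ≃o Set.Iic (⟨x, h⟩ : Set.Ici y) where
  toFun z := ⟨⟨z.1.1, z.2⟩, z.1.2⟩
  invFun z := ⟨⟨z.1.1, z.2⟩, z.1.2⟩
  left_inv _ := rfl
  right_inv _ := rfl
  map_rel_iff' := Iff.rfl

def iicTop [OrderTop Q] : Set.Iic (⊤ : Q) ≃o Q where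
  toFun z := z.1
  invFun z := ⟨z, le_top⟩
  left_inv _ := rfl
  right_inv _ := rfl
  map_rel_iff' := Iff.rfl

def iciBot [OrderBot Q] : Set.Ici (⊥ : Q) ≃o Q where
  toFun z := z.1
  invFun z := ⟨z, bot_le⟩
  left_inv _ := rfl
  right_inv _ := rfl
  map_rel_iff' := Iff.rfl

def uniqueIso [Subsingleton Q] [Subsingleton R] (q : Q) (r : R) : Q ≃o R where
  toFun _ := r
  invFun _ := q
  left_inv _ := Subsingleton.elim _ _
  right_inv _ := Subsingleton.elim _ _
  map_rel_iff' {a b} :=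
    ⟨fun _ => (Subsingleton.elim a b).le, fun _ => le_rfl⟩

end OrderIsos

/-- A product of two products is the product over the concatenated list. -/
def prdAppend {A : Type} (P : A → Type) [∀ a, PartialOrder (P a)] (l' : List A) :
    ∀ l : List A, Prd P l × Prd P l' ≃o Prd P (l ++ l')
  | [] => punitProdIso
  | a :: l =>
    (OrderIso.prodAssoc (P a) (Prd P l) (Prd P l')).trans
      (prodCongrIso (OrderIso.refl (P a)) (prdAppend P l' l))

variable (G) in
theorem InFam.prod (Q R : Type) [PartialOrder Q] [PartialOrder R] [hQ : InFam G Q]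
    [hR : InFam G R] : InFam G (Q × R) := by
  obtain ⟨l, ⟨e⟩⟩ := hQ.exists_iso
  obtain ⟨l', ⟨e'⟩⟩ := hR.exists_iso
  exact ⟨l ++ l', ⟨(prodCongrIso e e').trans (prdAppend G.P l' l)⟩⟩

instance instInFamProd (Q R : Type) [PartialOrder Q] [PartialOrder R] [InFam G Q]
    [InFam G R] : InFam G (Q × R) := InFam.prod G Q R

theorem inFam_iic_prd : ∀ (l : List G.A) (x : Prd G.P l), InFam G (Set.Iic x)
  | [], x => ⟨[], ⟨uniqueIso (Q := Set.Iic (α := PUnit) x) (R := PUnit)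
      (⟨x, le_refl (α := PUnit) x⟩ : Set.Iic x) PUnit.unit⟩⟩
  | a :: l, (x, y) => by
    have := inFam_iic_prd l y
    have : InFam G (Set.Iic x) := by
      obtain ⟨m, hm⟩ := G.initial a x
      exact ⟨m, hm⟩
    exact InFam.of_iso (G := G) (iicProd (Q := G.P a) (R := Prd G.P l) (x, y))

theorem inFam_ici_prd : ∀ (l : List G.A) (x : Prd G.P l), InFam G (Set.Ici x)
  | [], x => ⟨[], ⟨uniqueIso (Q := Set.Ici (α := PUnit) x) (R := PUnit)
      (⟨x, le_refl (α := PUnit) x⟩ : Set.Ici x) PUnit.unit⟩⟩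
  | a :: l, (x, y) => by
    have := inFam_ici_prd l y
    have : InFam G (Set.Ici x) := by
      obtain ⟨m, hm⟩ := G.final a x
      exact ⟨m, hm⟩
    exact InFam.of_iso (G := G) (iciProd (Q := G.P a) (R := Prd G.P l) (x, y))

instance instInFamIic {Q : Type} [PartialOrder Q] [h : InFam G Q] (x : Q) :
    InFam G (Set.Iic x) := by
  obtain ⟨l, ⟨e⟩⟩ := h.exists_iso
  have := inFam_iic_prd l (e x)
  exact InFam.of_iso (iicCongr e x)

instance instInFamIci {Q : Type} [PartialOrder Q] [h : InFam G Q] (x : Q) :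
    InFam G (Set.Ici x) := by
  obtain ⟨l, ⟨e⟩⟩ := h.exists_iso
  have := inFam_ici_prd l (e x)
  exact InFam.of_iso (iciCongr e x)

/-- `[Q] [R] = [Q × R]`. -/
instance instMulCls : Mul (Cls G) where
  mul := Quotient.map₂ (· ++ ·) fun l l' ⟨e⟩ m m' ⟨f⟩ =>
    ⟨(prdAppend G.P m l).symm.trans ((prodCongrIso e f).trans (prdAppend G.P m' l'))⟩

/-- The unit is the class of the one-element poset. -/
instance instOneCls : One (Cls G) := ⟨Quotient.mk (isoSetoid G) []⟩

theorem cls_prod (Q R : Type) [PartialOrder Q] [PartialOrder R] [hQ : InFam G Q]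
    [hR : InFam G R] : cls G (Q × R) = cls G Q * cls G R := by
  obtain ⟨l, ⟨e⟩⟩ := hQ.exists_iso
  obtain ⟨l', ⟨e'⟩⟩ := hR.exists_iso
  rw [cls_eq_mk e, cls_eq_mk e', cls_eq_mk ((prodCongrIso e e').trans (prdAppend G.P l' l))]
  rfl

theorem cls_one (Q : Type) [PartialOrder Q] [InFam G Q] [Subsingleton Q] (q : Q) :
    cls G Q = 1 :=
  cls_eq_mk (l := []) (uniqueIso (R := PUnit) q PUnit.unit)

theorem Cls.ind {p : Cls G → Prop} (h : ∀ l : List G.A, p (cls G (Prd G.P l))) (c : Cls G) :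
    p c := by
  induction c using Quotient.inductionOn with
  | h l => exact cls_prd l ▸ h l

instance instCommMonoidCls : CommMonoid (Cls G) where
  mul_assoc a b c := by
    induction a using Cls.ind
    induction b using Cls.ind
    induction c using Cls.ind
    rw [← cls_prod, ← cls_prod, ← cls_prod, ← cls_prod]
    exact cls_eq (OrderIso.prodAssoc _ _ _)
  one_mul a := by
    induction a using Quotient.inductionOn
    rfl
  mul_one a := by
    induction a using Quotient.inductionOn with
    | h l => exact congrArg (Quotient.mk (isoSetoid G)) (List.append_nil l)
  mul_comm a b := by
    induction a using Cls.ind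
    induction b using Cls.ind
    rw [← cls_prod, ← cls_prod]
    exact cls_eq OrderIso.prodComm

section Algebra

variable (G) (K : Type*) [CommRing K]

/-- The incidence algebra's underlying space: the free `K`-module on the isomorphism classes. Its
product is induced by the direct product of posets. -/
def Hopf : Type _ := MonoidAlgebra K (Cls G)

noncomputable instance instCommRingHopf : CommRing (Hopf G K) :=
  inferInstanceAs (CommRing (MonoidAlgebra K (Cls G)))

noncomputable instance instAlgebraHopf : Algebra K (Hopf G K) :=
  inferInstanceAs (Algebra K (MonoidAlgebra K (Cls G)))

/-- The basis `F_[α]`. -/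
noncomputable def Fbasis : Module.Basis (Cls G) K (Hopf G K) := MonoidAlgebra.basis (Cls G) K

/-- `F_[Q]`. -/
noncomputable def F (Q : Type) [PartialOrder Q] [InFam G Q] : Hopf G K := Fbasis G K (cls G Q)

theorem Fbasis_mul (a b : Cls G) : Fbasis G K (a * b) = Fbasis G K a * Fbasis G K b := by
  have h : ∀ c, Fbasis G K c = (MonoidAlgebra.single c 1 : MonoidAlgebra K (Cls G)) :=
    fun c => MonoidAlgebra.basis_apply _ _
  rw [h, h, h]
  exact (by simp [MonoidAlgebra.single_mul_single] :
    (MonoidAlgebra.single (a * b) 1 : MonoidAlgebra K (Cls G)) =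
      MonoidAlgebra.single a 1 * MonoidAlgebra.single b 1)

theorem Fbasis_one : Fbasis G K 1 = 1 := MonoidAlgebra.basis_apply _ _

/-- Algebra morphisms out of the incidence algebra. -/
noncomputable def liftAlg {B : Type*} [CommRing B] [Algebra K B] (f : Cls G →* B) :
    Hopf G K →ₐ[K] B := MonoidAlgebra.lift K B (Cls G) f

theorem liftAlg_F {B : Type*} [CommRing B] [Algebra K B] (f : Cls G →* B) (c : Cls G) :
    liftAlg G K f (Fbasis G K c) = f c := by
  have h : Fbasis G K c = (MonoidAlgebra.single c 1 : MonoidAlgebra K (Cls G)) :=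
    MonoidAlgebra.basis_apply _ _
  rw [h]
  exact (MonoidAlgebra.lift_single f c 1).trans (one_smul _ _)

variable {G}

theorem algHom_ext {B : Type*} [CommRing B] [Algebra K B] {f g : Hopf G K →ₐ[K] B}
    (h : ∀ l : List G.A, f (F G K (Prd G.P l)) = g (F G K (Prd G.P l))) : f = g := by
  have : f.toLinearMap = g.toLinearMap :=
    (Fbasis G K).ext fun c => Cls.ind (p := fun c => f (Fbasis G K c) = g (Fbasis G K c)) h c
  exact AlgHom.toLinearMap_injective this

variable (G)

theorem F_eq {Q R : Type} [PartialOrder Q] [PartialOrder R] [InFam G Q] [InFam G R]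
    (e : Q ≃o R) : F G K Q = F G K R := congrArg _ (cls_eq e)

theorem F_prod (Q R : Type) [PartialOrder Q] [PartialOrder R] [InFam G Q] [InFam G R] :
    F G K (Q × R) = F G K Q * F G K R := by
  rw [F, cls_prod, Fbasis_mul]; rfl

theorem F_one {Q : Type} [PartialOrder Q] [InFam G Q] [hQ : Subsingleton Q] (q : Q) :
    F G K Q = 1 := by
  rw [F, cls_one Q q, Fbasis_one]

/-- `∑_{x ∈ Q} F_[0̂, x] ⊗ F_[x, 1̂]`. -/
noncomputable def delta (Q : Type) [PartialOrder Q] [InFam G Q] [Fintype Q] :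
    Hopf G K ⊗[K] Hopf G K :=
  ∑ x : Q, F G K (Set.Iic x) ⊗ₜ[K] F G K (Set.Ici x)

theorem delta_eq {Q R : Type} [PartialOrder Q] [PartialOrder R] [InFam G Q] [InFam G R]
    [Fintype Q] [Fintype R] (e : Q ≃o R) : delta G K Q = delta G K R :=
  Fintype.sum_equiv e.toEquiv _ _ fun x => by
    rw [F_eq G K (iicCongr e x), F_eq G K (iciCongr e x)]; rfl

theorem delta_prod (Q R : Type) [PartialOrder Q] [PartialOrder R] [InFam G Q] [InFam G R]
    [Fintype Q] [Fintype R] :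
    delta G K (Q × R) = delta G K Q * delta G K R := by
  rw [delta, delta, delta, Finset.sum_mul_sum, ← Finset.sum_product',
    Finset.univ_product_univ]
  refine Fintype.sum_equiv (Equiv.refl _) _ _ fun x => ?_
  rw [F_eq G K (iicProd x), F_eq G K (iciProd x), F_prod, F_prod,
    Algebra.TensorProduct.tmul_mul_tmul]
  rfl

/-- The coproduct on the basis. -/
noncomputable def comulCls : Cls G → Hopf G K ⊗[K] Hopf G K :=
  Quotient.lift (fun l => delta G K (Prd G.P l)) fun _ _ ⟨e⟩ => delta_eq G K e

theorem comulCls_cls (Q : Type) [PartialOrder Q] [h : InFam G Q] [Fintype Q] :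
    comulCls G K (cls G Q) = delta G K Q := by
  obtain ⟨l, ⟨e⟩⟩ := h.exists_iso
  rw [cls_eq_mk e, delta_eq G K e]
  rfl

/-- The coproduct, as an algebra morphism. -/
noncomputable def comulHom : Hopf G K →ₐ[K] Hopf G K ⊗[K] Hopf G K :=
  liftAlg G K
    { toFun := comulCls G K
      map_one' := by
        change delta G K (Prd G.P []) = 1
        have : Subsingleton (Prd G.P []) := inferInstanceAs (Subsingleton PUnit)
        rw [delta, Fintype.sum_subsingleton _ ⊥,
          F_one G K (⟨⊥, Set.mem_Iic.2 le_rfl⟩ : Set.Iic (⊥ : Prd G.P [])),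
          F_one G K (⟨⊥, Set.mem_Ici.2 le_rfl⟩ : Set.Ici (⊥ : Prd G.P []))]
        rfl
      map_mul' := fun a b => by
        induction a using Cls.ind
        induction b using Cls.ind
        rw [← cls_prod, comulCls_cls, comulCls_cls, comulCls_cls, delta_prod] }

theorem comulHom_F (Q : Type) [PartialOrder Q] [InFam G Q] [Fintype Q] :
    comulHom G K (F G K Q) = ∑ x : Q, F G K (Set.Iic x) ⊗ₜ[K] F G K (Set.Ici x) :=
  (liftAlg_F G K _ _).trans (comulCls_cls G K Q)

open Classical in
/-- The counit on the basis: it is `1` on the class of the one-element poset and `0` on the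
others. -/
noncomputable def counitCls (c : Cls G) : K := if c = 1 then 1 else 0

theorem prd_nonempty (l : List G.A) : Nonempty (Prd G.P l) := ⟨⊥⟩

theorem InFam.nonempty (Q : Type) [PartialOrder Q] [h : InFam G Q] : Nonempty Q := by
  obtain ⟨l, ⟨e⟩⟩ := h.exists_iso
  exact ⟨e.symm ⊥⟩

theorem cls_eq_one_iff (Q : Type) [PartialOrder Q] [h : InFam G Q] :
    cls G Q = 1 ↔ Subsingleton Q := by
  constructor
  · intro hc
    obtain ⟨l, ⟨e⟩⟩ := h.exists_iso
    rw [cls_eq_mk e] at hc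
    obtain ⟨f⟩ := Quotient.exact hc
    have : Subsingleton (Prd G.P []) := inferInstanceAs (Subsingleton PUnit)
    exact (e.trans f).toEquiv.subsingleton
  · intro _
    exact cls_one Q (InFam.nonempty G Q).some

/-- The counit, as an algebra morphism. -/
noncomputable def counitHom : Hopf G K →ₐ[K] K :=
  liftAlg G K
    { toFun := counitCls G K
      map_one' := if_pos rfl
      map_mul' := fun a b => by
        classical
        induction a using Cls.ind with
        | h l =>
        induction b using Cls.ind with
        | h m =>
        rw [← cls_prod, counitCls, counitCls, counitCls, cls_eq_one_iff, cls_eq_one_iff,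
          cls_eq_one_iff]
        have := prd_nonempty G l
        have := prd_nonempty G m
        have : Subsingleton (Prd G.P l × Prd G.P m) ↔
            Subsingleton (Prd G.P l) ∧ Subsingleton (Prd G.P m) := by
          constructor
          · intro h
            exact ⟨⟨fun a b => congrArg Prod.fst (h.elim (a, ⊥) (b, ⊥))⟩,
              ⟨fun a b => congrArg Prod.snd (h.elim (⊥, a) (⊥, b))⟩⟩
          · rintro ⟨_, _⟩
            infer_instance
        by_cases h1 : Subsingleton (Prd G.P l) <;> by_cases h2 : Subsingleton (Prd G.P m) <;>
          simp [this, h1, h2] }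

open Classical in
theorem counitHom_F (Q : Type) [PartialOrder Q] [InFam G Q] :
    counitHom G K (F G K Q) = if Subsingleton Q then 1 else 0 := by
  refine (liftAlg_F G K _ _).trans ?_
  change counitCls G K _ = _
  rw [counitCls]
  simp only [cls_eq_one_iff]

theorem subsingleton_iic_iff {Q : Type} [PartialOrder Q] [BoundedOrder Q] (x : Q) :
    Subsingleton (Set.Iic x) ↔ x = ⊥ := by
  constructor
  · intro h
    exact congrArg Subtype.val
      (h.elim (⟨x, Set.mem_Iic.2 le_rfl⟩ : Set.Iic x) ⟨⊥, Set.mem_Iic.2 bot_le⟩)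
  · rintro rfl
    exact ⟨fun a b => Subtype.ext ((le_bot_iff.1 a.2).trans (le_bot_iff.1 b.2).symm)⟩

theorem subsingleton_ici_iff {Q : Type} [PartialOrder Q] [BoundedOrder Q] (x : Q) :
    Subsingleton (Set.Ici x) ↔ x = ⊤ := by
  constructor
  · intro h
    exact congrArg Subtype.val
      (h.elim (⟨x, Set.mem_Ici.2 le_rfl⟩ : Set.Ici x) ⟨⊤, Set.mem_Ici.2 le_top⟩)
  · rintro rfl
    exact ⟨fun a b => Subtype.ext ((top_le_iff.1 a.2).trans (top_le_iff.1 b.2).symm)⟩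

/-- Chains `y ≤ x`, sorted by `x` or by `y`. -/
def chainEquiv (Q : Type) [PartialOrder Q] :
    (Σ x : Q, Set.Iic x) ≃ (Σ y : Q, Set.Ici y) where
  toFun p := ⟨p.2.1, ⟨p.1, p.2.2⟩⟩
  invFun p := ⟨p.2.1, ⟨p.1, p.2.2⟩⟩
  left_inv _ := rfl
  right_inv _ := rfl

noncomputable instance instBialgebraHopf : Bialgebra K (Hopf G K) :=
  Bialgebra.ofAlgHom (comulHom G K) (counitHom G K)
    (by
      classical
      refine algHom_ext K fun l => ?_
      have h1 : ∀ x : Prd G.P l, Fintype (Set.Iic x) := fun x => Fintype.ofFinite _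
      have h2 : ∀ x : Prd G.P l, Fintype (Set.Ici x) := fun x => Fintype.ofFinite _
      simp only [AlgHom.comp_apply, comulHom_F, map_sum, Algebra.TensorProduct.map_tmul,
        AlgHom.id_apply, TensorProduct.sum_tmul, TensorProduct.tmul_sum]
      rw [← Fintype.sum_sigma', ← Fintype.sum_sigma']
      refine Fintype.sum_equiv (chainEquiv _) _ _ fun p => ?_
      rcases p with ⟨x, y, hy⟩
      change F G K (Set.Iic (⟨y, hy⟩ : Set.Iic x)) ⊗ₜ[K]
          (F G K (Set.Ici (⟨y, hy⟩ : Set.Iic x)) ⊗ₜ[K] F G K (Set.Ici x)) =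
        F G K (Set.Iic y) ⊗ₜ[K] (F G K (Set.Iic (⟨x, hy⟩ : Set.Ici y)) ⊗ₜ[K]
          F G K (Set.Ici (⟨x, hy⟩ : Set.Ici y)))
      rw [F_eq G K (iicIic (⟨y, hy⟩ : Set.Iic x)), F_eq G K (iciIic hy),
        F_eq G K (iciIci (⟨x, hy⟩ : Set.Ici y))])
    (by
      classical
      refine algHom_ext K fun l => ?_
      simp only [AlgHom.comp_apply, comulHom_F, map_sum, Algebra.TensorProduct.map_tmul,
        AlgHom.id_apply, counitHom_F, subsingleton_iic_iff, TensorProduct.ite_tmul,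
        Finset.sum_ite_eq', Finset.mem_univ, if_true]
      rw [F_eq G K (iciBot (Q := Prd G.P l))]
      rfl)
    (by
      classical
      refine algHom_ext K fun l => ?_
      simp only [AlgHom.comp_apply, comulHom_F, map_sum, Algebra.TensorProduct.map_tmul,
        AlgHom.id_apply, counitHom_F, subsingleton_ici_iff, TensorProduct.tmul_ite,
        Finset.sum_ite_eq', Finset.mem_univ, if_true]
      rw [F_eq G K (iicTop (Q := Prd G.P l))]
      rfl)

theorem comul_F (Q : Type) [PartialOrder Q] [InFam G Q] [Fintype Q] :
    Coalgebra.comul (R := K) (F G K Q) =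
      ∑ x : Q, F G K (Set.Iic x) ⊗ₜ[K] F G K (Set.Ici x) :=
  comulHom_F G K Q

open Classical in
theorem counit_F (Q : Type) [PartialOrder Q] [InFam G Q] :
    Coalgebra.counit (R := K) (F G K Q) = if Subsingleton Q then 1 else 0 :=
  counitHom_F G K Q

variable {G}

/-- The number of elements of a poset with given isomorphism class. -/
noncomputable def Cls.card : Cls G → ℕ :=
  Quotient.lift (fun l => Nat.card (Prd G.P l)) fun _ _ ⟨e⟩ => Nat.card_congr e.toEquiv

theorem Cls.card_cls (Q : Type) [PartialOrder Q] [h : InFam G Q] :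
    (cls G Q).card = Nat.card Q := by
  obtain ⟨l, ⟨e⟩⟩ := h.exists_iso
  rw [cls_eq_mk e]
  exact (Nat.card_congr e.toEquiv).symm

theorem cls_out (c : Cls G) : cls G (Prd G.P (Quotient.out c)) = c :=
  (cls_prd _).trans (Quotient.out_eq c)

theorem card_iic_lt {Q : Type} [PartialOrder Q] [BoundedOrder Q] [Finite Q] {x : Q}
    (hx : x ≠ ⊤) : Nat.card (Set.Iic x) < Nat.card Q :=
  Finite.card_subtype_lt (x := ⊤) fun h => hx (top_le_iff.1 h)

theorem card_ici_lt {Q : Type} [PartialOrder Q] [BoundedOrder Q] [Finite Q] {x : Q}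
    (hx : x ≠ ⊥) : Nat.card (Set.Ici x) < Nat.card Q :=
  Finite.card_subtype_lt (x := ⊥) fun h => hx (le_bot_iff.1 h)

open Classical in
/-- The left convolution inverse of the identity, on the basis. -/
noncomputable def antipodeL (c : Cls G) : Hopf G K :=
  counitCls G K c • 1 - ∑ x : {x : Prd G.P (Quotient.out c) // x ≠ ⊤},
    antipodeL (cls G (Set.Iic x.1)) * F G K (Set.Ici x.1)
termination_by c.card
decreasing_by
  conv_rhs => rw [← cls_out c]
  rw [Cls.card_cls, Cls.card_cls]
  exact card_iic_lt x.2

open Classical in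
/-- The right convolution inverse of the identity, on the basis. -/
noncomputable def antipodeR (c : Cls G) : Hopf G K :=
  counitCls G K c • 1 - ∑ x : {x : Prd G.P (Quotient.out c) // x ≠ ⊥},
    F G K (Set.Iic x.1) * antipodeR (cls G (Set.Ici x.1))
termination_by c.card
decreasing_by
  conv_rhs => rw [← cls_out c]
  rw [Cls.card_cls, Cls.card_cls]
  exact card_ici_lt x.2

theorem antipodeL_sum (c : Cls G) :
    ∑ x : Prd G.P (Quotient.out c),
      antipodeL K (cls G (Set.Iic x)) * F G K (Set.Ici x) = counitCls G K c • 1 := by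
  classical
  rw [← Fintype.sum_subtype_add_sum_subtype (fun x => x ≠ ⊤)]
  have h : antipodeL K c = counitCls G K c • 1 -
      ∑ x : {x : Prd G.P (Quotient.out c) // x ≠ ⊤},
        antipodeL K (cls G (Set.Iic x.1)) * F G K (Set.Ici x.1) := by
    conv_lhs => rw [antipodeL]
  have h2 : ∑ x : {x : Prd G.P (Quotient.out c) // ¬ x ≠ ⊤},
        antipodeL K (cls G (Set.Iic x.1)) * F G K (Set.Ici x.1) = antipodeL K c := by
    have : Unique {x : Prd G.P (Quotient.out c) // ¬ x ≠ ⊤} :=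
      ⟨⟨⟨⊤, by simp⟩⟩, fun x => Subtype.ext (not_not.1 x.2)⟩
    rw [Fintype.sum_subsingleton _ ⟨⊤, by simp⟩, cls_eq iicTop, cls_out,
      F_one G K (⟨⊤, Set.mem_Ici.2 le_rfl⟩ : Set.Ici (⊤ : Prd G.P (Quotient.out c)))
        (hQ := (subsingleton_ici_iff _).2 rfl), mul_one]
  rw [h2, h]
  abel

theorem antipodeR_sum (c : Cls G) :
    ∑ x : Prd G.P (Quotient.out c),
      F G K (Set.Iic x) * antipodeR K (cls G (Set.Ici x)) = counitCls G K c • 1 := by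
  classical
  rw [← Fintype.sum_subtype_add_sum_subtype (fun x => x ≠ ⊥)]
  have h : antipodeR K c = counitCls G K c • 1 -
      ∑ x : {x : Prd G.P (Quotient.out c) // x ≠ ⊥},
        F G K (Set.Iic x.1) * antipodeR K (cls G (Set.Ici x.1)) := by
    conv_lhs => rw [antipodeR]
  have h2 : ∑ x : {x : Prd G.P (Quotient.out c) // ¬ x ≠ ⊥},
        F G K (Set.Iic x.1) * antipodeR K (cls G (Set.Ici x.1)) = antipodeR K c := by
    have : Unique {x : Prd G.P (Quotient.out c) // ¬ x ≠ ⊥} :=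
      ⟨⟨⟨⊥, by simp⟩⟩, fun x => Subtype.ext (not_not.1 x.2)⟩
    rw [Fintype.sum_subsingleton _ ⟨⊥, by simp⟩, cls_eq iciBot, cls_out,
      F_one G K (⟨⊥, Set.mem_Iic.2 le_rfl⟩ : Set.Iic (⊥ : Prd G.P (Quotient.out c)))
        (hQ := (subsingleton_iic_iff _).2 rfl), one_mul]
  rw [h2, h]
  abel

variable (G)

open LinearMap in
noncomputable instance instHopfAlgebraHopf : HopfAlgebra K (Hopf G K) := by
  have hL : WithConv.toConv ((Fbasis G K).constr K (antipodeL K)) *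
      WithConv.toConv (LinearMap.id (R := K) (M := Hopf G K)) = 1 := by
    refine WithConv.ext ((Fbasis G K).ext fun c => ?_)
    have hc : Fbasis G K c = F G K (Prd G.P (Quotient.out c)) := by rw [F, cls_out]
    change LinearMap.mul' K _ (TensorProduct.map ((Fbasis G K).constr K (antipodeL K)) LinearMap.id (Coalgebra.comul (R := K) (Fbasis G K c)))
      = algebraMap K _ (Coalgebra.counit (R := K) (Fbasis G K c))
    have h1 : Coalgebra.counit (R := K) (Fbasis G K c) = counitCls G K c := liftAlg_F G K _ _
    have h2 : ∀ (Q : Type) [PartialOrder Q] [InFam G Q],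
        (Fbasis G K).constr K (antipodeL K) (F G K Q) = antipodeL K (cls G Q) := fun Q _ _ =>
      (Fbasis G K).constr_basis K _ _
    rw [h1, Algebra.algebraMap_eq_smul_one, ← antipodeL_sum, hc, comul_F]
    simp only [map_sum, TensorProduct.map_tmul, LinearMap.mul'_apply, h2, LinearMap.id_apply]
  have hR : WithConv.toConv (LinearMap.id (R := K) (M := Hopf G K)) *
      WithConv.toConv ((Fbasis G K).constr K (antipodeR K)) = 1 := by
    refine WithConv.ext ((Fbasis G K).ext fun c => ?_)
    have hc : Fbasis G K c = F G K (Prd G.P (Quotient.out c)) := by rw [F, cls_out]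
    change LinearMap.mul' K _ (TensorProduct.map LinearMap.id ((Fbasis G K).constr K (antipodeR K)) (Coalgebra.comul (R := K) (Fbasis G K c)))
      = algebraMap K _ (Coalgebra.counit (R := K) (Fbasis G K c))
    have h1 : Coalgebra.counit (R := K) (Fbasis G K c) = counitCls G K c := liftAlg_F G K _ _
    have h2 : ∀ (Q : Type) [PartialOrder Q] [InFam G Q],
        (Fbasis G K).constr K (antipodeR K) (F G K Q) = antipodeR K (cls G Q) := fun Q _ _ =>
      (Fbasis G K).constr_basis K _ _
    rw [h1, Algebra.algebraMap_eq_smul_one, ← antipodeR_sum, hc, comul_F]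
    simp only [map_sum, TensorProduct.map_tmul, LinearMap.mul'_apply, h2, LinearMap.id_apply]
  exact HopfAlgebra.ofConvInverse ((Fbasis G K).constr K (antipodeL K)) hL
    (by rw [left_inv_eq_right_inv hL hR]; exact hR)

end Algebra

end Incidence

/-- The set `NAP(I)` of rooted trees with vertex set `I`. A rooted tree is given by its root and
by the map sending every other vertex to the next vertex on the path to the root (and the root to
itself); the edges are the pairs `{i, parent i}`, for `i ≠ root`. -/
structure NAP (I : Type) where
  root : I
  parent : I → I
  parent_root : parent root = root
  reach : ∀ i, ∃ n, parent^[n] i = root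

namespace NAP

variable {I J : Type}

theorem parent_eq_self_iff (t : NAP I) (i : I) : t.parent i = i ↔ i = t.root := by
  constructor
  · intro h
    obtain ⟨n, hn⟩ := t.reach i
    rwa [Function.iterate_fixed h n] at hn
  · rintro rfl
    exact t.parent_root

theorem ext_parent {s t : NAP I} (h : s.parent = t.parent) : s = t := by
  have hr : s.root = t.root := by
    rw [← t.parent_eq_self_iff, ← h, s.parent_root]
  cases s
  cases t
  cases h
  cases hr
  rfl

/-- Transport of a rooted tree along a bijection of the vertices. -/
def relabel (e : I ≃ J) (t : NAP I) : NAP J where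
  root := e t.root
  parent j := e (t.parent (e.symm j))
  parent_root := by simp [t.parent_root]
  reach j := by
    obtain ⟨n, hn⟩ := t.reach (e.symm j)
    refine ⟨n, ?_⟩
    have h : Function.Semiconj e t.parent (fun j => e (t.parent (e.symm j))) := fun i => by simp
    have := (h.iterate_right n).eq (e.symm j)
    rw [hn, e.apply_symm_apply] at this
    exact this.symm

open Classical in
/-- The composition `t ∘ (s_i)` of the operad: in the disjoint union of the trees `s_i`, an edge
between the roots of `s_i` and `s_i'` is added for every edge between `i` and `i'` in `t`. -/
noncomputable def comp {J : I → Type} (t : NAP I) (s : ∀ i, NAP (J i)) : NAP (Σ i, J i) where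
  root := ⟨t.root, (s t.root).root⟩
  parent p :=
    if p.2 = (s p.1).root then ⟨t.parent p.1, (s (t.parent p.1)).root⟩
    else ⟨p.1, (s p.1).parent p.2⟩
  parent_root := by
    rw [if_pos rfl]
    exact congrArg (fun i => (⟨i, (s i).root⟩ : Σ i, J i)) t.parent_root
  reach p := by
    set f : (Σ i, J i) → (Σ i, J i) := fun p =>
      if p.2 = (s p.1).root then ⟨t.parent p.1, (s (t.parent p.1)).root⟩
      else ⟨p.1, (s p.1).parent p.2⟩ with hf
    have h1 : ∀ i n (a : J i), (s i).parent^[n] a = (s i).root →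
        ∃ m, f^[m] ⟨i, a⟩ = ⟨i, (s i).root⟩ := by
      intro i n
      induction n with
      | zero => rintro a h; exact ⟨0, by simpa using h⟩
      | succ n ih =>
        intro a h
        by_cases ha : a = (s i).root
        · exact ⟨0, by simp [ha]⟩
        · obtain ⟨m, hm⟩ := ih ((s i).parent a) h
          exact ⟨m + 1, by rw [Function.iterate_succ_apply, hf]; simpa [ha] using hm⟩
    have h2 : ∀ n i, t.parent^[n] i = t.root →
        ∃ m, f^[m] ⟨i, (s i).root⟩ = ⟨t.root, (s t.root).root⟩ := by
      intro n
      induction n with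
      | zero => rintro i rfl; exact ⟨0, rfl⟩
      | succ n ih =>
        intro i h
        obtain ⟨m, hm⟩ := ih (t.parent i) h
        exact ⟨m + 1, by rw [Function.iterate_succ_apply, hf]; simpa using hm⟩
    obtain ⟨n, hn⟩ := (s p.1).reach p.2
    obtain ⟨m, hm⟩ := h1 p.1 n p.2 hn
    obtain ⟨n', hn'⟩ := t.reach p.1
    obtain ⟨m', hm'⟩ := h2 n' p.1 hn'
    refine ⟨m' + m, ?_⟩
    rw [Function.iterate_add_apply]
    change f^[m'] (f^[m] ⟨p.1, p.2⟩) = _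
    rw [hm, hm']

open Classical in
/-- The rooted tree `B(r, t_1, …, t_k)`: a new root `r` (the vertex `none`) is joined to the root
of each `t_i`. -/
noncomputable def graft {ι : Type} {J : ι → Type} (t : ∀ i, NAP (J i)) :
    NAP (Option (Σ i, J i)) where
  root := none
  parent
    | none => none
    | some p => if p.2 = (t p.1).root then none else some ⟨p.1, (t p.1).parent p.2⟩
  parent_root := rfl
  reach := by
    set f : Option (Σ i, J i) → Option (Σ i, J i) := fun p => match p with
      | none => none
      | some p => if p.2 = (t p.1).root then none else some ⟨p.1, (t p.1).parent p.2⟩ with hf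
    have h1 : ∀ i n (a : J i), (t i).parent^[n] a = (t i).root →
        ∃ m, f^[m] (some ⟨i, a⟩) = none := by
      intro i n
      induction n with
      | zero => rintro a h; exact ⟨1, by simpa [hf] using h⟩
      | succ n ih =>
        intro a h
        by_cases ha : a = (t i).root
        · exact ⟨1, by simp [hf, ha]⟩
        · obtain ⟨m, hm⟩ := ih ((t i).parent a) h
          exact ⟨m + 1, by rw [Function.iterate_succ_apply, hf]; simpa [ha] using hm⟩
    rintro (_ | ⟨i, a⟩)
    · exact ⟨0, rfl⟩
    · obtain ⟨n, hn⟩ := (t i).reach a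
      exact h1 i n a hn

end NAP

/-- The set `Π_NAP(I) = (Comm ∘ NAP)(I)`: a partition of `I`, together with a rooted tree on every
part. -/
structure PiNAP (I : Type) where
  part : Setoid I
  tree : ∀ u : Quotient part, NAP {i : I // Quotient.mk part i = u}

namespace PiNAP

variable {I J : Type}

/-- Transport along a bijection. -/
def relabel (e : I ≃ J) (x : PiNAP I) : PiNAP J where
  part := x.part.comap e.symm
  tree u :=
    (x.tree (Quotient.map e.symm (fun _ _ h => h) u)).relabel
      { toFun := fun i => ⟨e i.1, by
          obtain ⟨i, hi⟩ := i
          induction u using Quotient.inductionOn with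
          | h j =>
          refine Quotient.sound ?_
          have := Quotient.exact hi
          change x.part (e.symm (e i)) (e.symm j)
          rwa [e.symm_apply_apply]⟩
        invFun := fun j => ⟨e.symm j.1, by
          obtain ⟨j, rfl⟩ := j
          rfl⟩
        left_inv := fun i => Subtype.ext (e.symm_apply_apply i.1)
        right_inv := fun j => Subtype.ext (e.apply_symm_apply j.1) }

/-- The composition `x ∘ (s_i)`, for `x ∈ Π_NAP(I)` and `s_i ∈ NAP(J_i)`: every tree `x_u` is
replaced by the tree `x_u ∘ (s_i)_{i ∈ u}`. -/
noncomputable def comp {J : I → Type} (x : PiNAP I) (s : ∀ i, NAP (J i)) : PiNAP (Σ i, J i) where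
  part := x.part.comap Sigma.fst
  tree u :=
    ((x.tree (Quotient.map Sigma.fst (fun _ _ h => h) u)).comp fun i => s i.1).relabel
      { toFun := fun p => ⟨⟨p.1.1, p.2⟩, by
          obtain ⟨⟨i, hi⟩, a⟩ := p
          induction u using Quotient.inductionOn with
          | h q => exact Quotient.sound (Quotient.exact hi : x.part i q.1)⟩
        invFun := fun p => ⟨⟨p.1.1, by
          obtain ⟨p, rfl⟩ := p
          rfl⟩, p.1.2⟩
        left_inv := fun _ => rfl
        right_inv := fun _ => rfl }

/-- `x ≤ y` if there is `θ ∈ Π_NAP(π_x)`, where `π_x` is the set of parts of `x`, such that the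
composition of `θ` with the trees of `x` is `y`; the disjoint union of the parts of `x` is
identified with `I`. -/
noncomputable instance instLE : LE (PiNAP I) where
  le x y := ∃ θ : PiNAP (Quotient x.part),
    (θ.comp x.tree).relabel (Equiv.sigmaFiberEquiv (Quotient.mk x.part)) = y

/-- A rooted tree on `I`, as an element of `Π_NAP(I)` with only one part. -/
def ofTree (t : NAP I) : PiNAP I where
  part := ⊤
  tree u := t.relabel
    (Equiv.subtypeUnivEquiv fun i => by
      induction u using Quotient.inductionOn with
      | h j => exact Quotient.sound trivial).symm

/-- The map sending every vertex to its parent in its tree. -/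
def par (x : PiNAP I) (i : I) : I := ((x.tree (Quotient.mk x.part i)).parent ⟨i, rfl⟩).1

theorem tree_parent (x : PiNAP I) (u : Quotient x.part) (i : {i : I // Quotient.mk x.part i = u}) :
    ((x.tree u).parent i).1 = x.par i.1 := by
  obtain ⟨i, rfl⟩ := i
  rfl

/-- The root of a part. -/
def rt (x : PiNAP I) (u : Quotient x.part) : I := (x.tree u).root.1

theorem mk_rt (x : PiNAP I) (u : Quotient x.part) : Quotient.mk x.part (x.rt u) = u :=
  (x.tree u).root.2

theorem mk_par (x : PiNAP I) (i : I) :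
    Quotient.mk x.part (x.par i) = Quotient.mk x.part i :=
  ((x.tree (Quotient.mk x.part i)).parent ⟨i, rfl⟩).2

theorem par_eq_self_iff (x : PiNAP I) (i : I) :
    x.par i = i ↔ i = x.rt (Quotient.mk x.part i) := by
  have := (x.tree (Quotient.mk x.part i)).parent_eq_self_iff ⟨i, rfl⟩
  rw [Subtype.ext_iff, Subtype.ext_iff] at this
  exact this

theorem par_rt (x : PiNAP I) (u : Quotient x.part) : x.par (x.rt u) = x.rt u := by
  rw [par_eq_self_iff, mk_rt]

theorem reach (x : PiNAP I) (i : I) : ∃ n, x.par^[n] i = x.rt (Quotient.mk x.part i) := by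
  obtain ⟨n, hn⟩ := (x.tree (Quotient.mk x.part i)).reach ⟨i, rfl⟩
  refine ⟨n, ?_⟩
  have h : Function.Semiconj Subtype.val (x.tree (Quotient.mk x.part i)).parent x.par :=
    fun j => tree_parent _ _ j
  have := (h.iterate_right n).eq ⟨i, rfl⟩
  rw [hn] at this
  exact this.symm

theorem part_iff (x : PiNAP I) (i j : I) :
    x.part i j ↔ ∃ m n, x.par^[m] i = x.par^[n] j := by
  have h : ∀ n i, Quotient.mk x.part (x.par^[n] i) = Quotient.mk x.part i := by
    intro n
    induction n with
    | zero => intro i; rfl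
    | succ n ih => intro i; rw [Function.iterate_succ_apply, ih, mk_par]
  constructor
  · intro hij
    obtain ⟨m, hm⟩ := x.reach i
    obtain ⟨n, hn⟩ := x.reach j
    exact ⟨m, n, by rw [hm, hn, (Quotient.sound hij : Quotient.mk x.part i = _)]⟩
  · rintro ⟨m, n, hmn⟩
    exact Quotient.exact (by rw [← h m, hmn, h n])

theorem ext_par {x y : PiNAP I} (h : x.par = y.par) : x = y := by
  have hp : x.part = y.part := Setoid.ext fun i j => by rw [part_iff, part_iff, h]
  obtain ⟨p, s⟩ := x
  obtain ⟨q, t⟩ := y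
  obtain rfl : p = q := hp
  congr
  funext u
  refine NAP.ext_parent (funext fun i => Subtype.ext ?_)
  have h1 := tree_parent ⟨p, s⟩ u i
  have h2 := tree_parent ⟨p, t⟩ u i
  rw [h] at h1
  exact h1.trans h2.symm

/-- The element of `Π_NAP(I)` with given parents. -/
noncomputable def ofPar (p : I → I) (hp : ∀ i, ∃ n, p (p^[n] i) = p^[n] i) : PiNAP I where
  part :=
    { r := fun i j => ∃ m n, p^[m] i = p^[n] j
      iseqv :=
        ⟨fun i => ⟨0, 0, rfl⟩, fun ⟨m, n, h⟩ => ⟨n, m, h.symm⟩, fun {i j k} ⟨m, n, h⟩ ⟨m', n', h'⟩ =>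
          ⟨m' + m, n + n', by
            rw [Function.iterate_add_apply, h, ← Function.iterate_add_apply, Nat.add_comm,
              Function.iterate_add_apply, h', ← Function.iterate_add_apply]⟩⟩ }
  tree u :=
    have h : ∃ r : {i : I // Quotient.mk _ i = u}, p r.1 = r.1 := by
      induction u using Quotient.inductionOn with
      | h j =>
      obtain ⟨n, hn⟩ := hp j
      exact ⟨⟨p^[n] j, Quotient.sound ⟨0, n, rfl⟩⟩, hn⟩
    { root := h.choose
      parent := fun i => ⟨p i.1, Eq.trans (Quotient.sound ⟨0, 1, rfl⟩) i.2⟩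
      parent_root := Subtype.ext h.choose_spec
      reach := fun i => by
        obtain ⟨m, n, hmn⟩ := Quotient.exact (i.2.trans h.choose.2.symm)
        rw [Function.iterate_fixed h.choose_spec] at hmn
        have hs : Function.Semiconj (Subtype.val : {i : I // Quotient.mk _ i = u} → I)
            (fun i => ⟨p i.1, Eq.trans (Quotient.sound ⟨0, 1, rfl⟩) i.2⟩) p := fun _ => rfl
        exact ⟨m, Subtype.ext (((hs.iterate_right m).eq i).trans hmn)⟩ }

theorem par_ofPar (p : I → I) (hp : ∀ i, ∃ n, p (p^[n] i) = p^[n] i) :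
    (ofPar p hp).par = p := rfl

theorem par_fixed (x : PiNAP I) (i : I) : ∃ n, x.par (x.par^[n] i) = x.par^[n] i := by
  obtain ⟨n, hn⟩ := x.reach i
  exact ⟨n, by rw [hn, par_rt]⟩

theorem par_relabel (e : I ≃ J) (x : PiNAP I) (j : J) :
    (x.relabel e).par j = e (x.par (e.symm j)) := rfl

theorem par_ofTree (t : NAP I) : (ofTree t).par = t.parent := rfl

open Classical in
theorem par_comp {J : I → Type} (x : PiNAP I) (s : ∀ i, NAP (J i)) (p : Σ i, J i) :
    (x.comp s).par p =
      if p.2 = (s p.1).root then ⟨x.par p.1, (s (x.par p.1)).root⟩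
      else ⟨p.1, (s p.1).parent p.2⟩ := by
  exact apply_ite (fun q : (Σ i : {i // Quotient.mk x.part i = Quotient.mk x.part p.1}, J i.1) =>
    (⟨q.1.1, q.2⟩ : Σ i, J i)) (p.2 = (s p.1).root)
    ⟨(x.tree (Quotient.mk x.part p.1)).parent ⟨p.1, rfl⟩, (s _).root⟩
    ⟨⟨p.1, rfl⟩, (s p.1).parent p.2⟩

open Classical in
/-- The element `θ ∘ x` of `Π_NAP(I)`, for `θ ∈ Π_NAP(π_x)`. -/
noncomputable def glue (x : PiNAP I) (θ : PiNAP (Quotient x.part)) : PiNAP I :=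
  (θ.comp x.tree).relabel (Equiv.sigmaFiberEquiv (Quotient.mk x.part))

theorem le_def {x y : PiNAP I} : x ≤ y ↔ ∃ θ, x.glue θ = y := Iff.rfl

open Classical in
theorem par_glue (x : PiNAP I) (θ : PiNAP (Quotient x.part)) (i : I) :
    (x.glue θ).par i = if x.par i = i then x.rt (θ.par (Quotient.mk x.part i)) else x.par i := by
  rw [glue, par_relabel, par_comp]
  have h : ((⟨i, rfl⟩ : {j // Quotient.mk x.part j = Quotient.mk x.part i}) =
      (x.tree (Quotient.mk x.part i)).root) ↔ x.par i = i := by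
    rw [par_eq_self_iff, Subtype.ext_iff]
    rfl
  by_cases hi : x.par i = i
  · rw [if_pos hi]
    exact congrArg (Equiv.sigmaFiberEquiv (Quotient.mk x.part)) (if_pos (h.2 hi))
  · rw [if_neg hi]
    exact congrArg (Equiv.sigmaFiberEquiv (Quotient.mk x.part)) (if_neg fun h' => hi (h.1 h'))

theorem le_iff {x y : PiNAP I} : x ≤ y ↔
    ∀ i, (x.par i ≠ i → y.par i = x.par i) ∧ (x.par i = i → x.par (y.par i) = y.par i) := by
  classical
  constructor
  · rintro ⟨θ, hθ⟩ i
    have h := x.par_glue θ i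
    rw [show x.glue θ = y from hθ] at h
    constructor
    · intro hi
      rw [h, if_neg hi]
    · intro hi
      rw [h, if_pos hi, par_rt]
  · intro h
    have hs : ∀ u : Quotient x.part, x.rt (Quotient.mk x.part (y.par (x.rt u))) =
        y.par (x.rt u) := fun u =>
      ((x.par_eq_self_iff _).1 ((h _).2 (x.par_rt u))).symm
    have hsc : Function.Semiconj x.rt
        (fun u : Quotient x.part => Quotient.mk x.part (y.par (x.rt u))) y.par := hs
    refine ⟨ofPar (fun u => Quotient.mk x.part (y.par (x.rt u))) ?_, ?_⟩
    · intro u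
      obtain ⟨n, hn⟩ := y.par_fixed (x.rt u)
      refine ⟨n, ?_⟩
      rw [(hsc.iterate_right n).eq, hn, ← (hsc.iterate_right n).eq, mk_rt]
    · refine ext_par (funext fun i => ?_)
      change (x.glue _).par i = _
      rw [par_glue, par_ofPar]
      split_ifs with hi
      · rw [hs, ← (x.par_eq_self_iff i).1 hi]
      · exact ((h i).1 hi).symm

theorem par_eq_of_le {x y : PiNAP I} (h : x ≤ y) {i : I} (hi : y.par i = i) : x.par i = i := by
  by_contra hx
  exact hx (((le_iff.1 h i).1 hx).symm.trans hi)

noncomputable instance instPartialOrder : PartialOrder (PiNAP I) where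
  le_refl x := le_iff.2 fun i => ⟨fun _ => rfl, fun h => by rw [h, h]⟩
  le_trans x y z hxy hyz := le_iff.2 fun i => by
    constructor
    · intro hi
      have h1 := (le_iff.1 hxy i).1 hi
      rw [(le_iff.1 hyz i).1 (by rwa [h1]), h1]
    · intro hi
      by_cases hy : y.par i = i
      · exact par_eq_of_le hxy ((le_iff.1 hyz i).2 hy)
      · rw [(le_iff.1 hyz i).1 hy]
        exact (le_iff.1 hxy i).2 hi
  le_antisymm x y hxy hyx := ext_par (funext fun i => by
    by_cases hi : x.par i = i
    · rw [hi, par_eq_of_le hyx hi]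
    · exact ((le_iff.1 hxy i).1 hi).symm)

/-- The least element: every part has only one vertex. -/
noncomputable instance instBot : Bot (PiNAP I) := ⟨ofPar id fun _ => ⟨0, rfl⟩⟩

noncomputable instance instOrderBot : OrderBot (PiNAP I) where
  bot_le _ := le_iff.2 fun _ => ⟨fun h => absurd rfl h, fun _ => rfl⟩

instance instFinite [Finite I] : Finite (PiNAP I) :=
  Finite.of_injective par fun _ _ => ext_par

/-- The sets of vertices that contain no root, and contain every vertex whose parent they
contain. -/
def Down (p : I → I) : Type :=
  {N : Set I // (∀ i ∈ N, p i ≠ i) ∧ ∀ i, p i ∈ N → i ∈ N}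

instance instPartialOrderDown (p : I → I) : PartialOrder (Down p) :=
  inferInstanceAs (PartialOrder {N : Set I // (∀ i ∈ N, p i ≠ i) ∧ ∀ i, p i ∈ N → i ∈ N})

theorem reach_ite (x : PiNAP I) (N : Set I) [DecidablePred (· ∈ N)] (i : I) :
    ∃ n, (fun i => if i ∈ N then x.par i else i) ((fun i => if i ∈ N then x.par i else i)^[n] i) =
      (fun i => if i ∈ N then x.par i else i)^[n] i := by
  obtain ⟨n, hn⟩ := x.par_fixed i
  induction n generalizing i with
  | zero =>
    refine ⟨0, ?_⟩
    have h : x.par i = i := hn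
    simp [h]
  | succ n ih =>
    by_cases hi : i ∈ N
    · obtain ⟨m, hm⟩ := ih (x.par i) hn
      refine ⟨m + 1, ?_⟩
      rw [Function.iterate_succ_apply]
      simpa only [if_pos hi] using hm
    · exact ⟨0, by simp [hi]⟩

open Classical in
/-- An element `z` of `[0̂, x]` is determined by the set of vertices which are not roots of `z`. -/
noncomputable def iicIso (x : PiNAP I) : Set.Iic x ≃o Down x.par where
  toFun z := ⟨{i | z.1.par i ≠ i}, by
    constructor
    · intro i hi
      rwa [(le_iff.1 z.2 i).1 hi]
    · intro i hi hz
      exact hi ((le_iff.1 z.2 i).2 hz)⟩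
  invFun N := ⟨ofPar (fun i => if i ∈ N.1 then x.par i else i) (x.reach_ite N.1), by
    refine le_iff.2 fun i => ?_
    rw [par_ofPar]
    constructor
    · intro h
      by_cases hi : i ∈ N.1
      · simp [hi]
      · simp [hi] at h
    · intro h
      by_cases hi : i ∈ N.1
      · rw [if_pos hi] at h
        exact absurd h (N.2.1 i hi)
      · rw [if_neg fun h' => hi (N.2.2 i h')]⟩
  left_inv z := by
    refine Subtype.ext (ext_par (funext fun i => ?_))
    by_cases h : z.1.par i ≠ i
    · exact (if_pos h).trans ((le_iff.1 z.2 i).1 h)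
    · exact (if_neg h).trans (not_not.1 h).symm
  right_inv N := by
    refine Subtype.ext (Set.ext fun i => ?_)
    change (if i ∈ N.1 then x.par i else i) ≠ i ↔ _
    by_cases hi : i ∈ N.1
    · simpa [hi] using N.2.1 i hi
    · simp [hi]
  map_rel_iff' {z w} := by
    change (∀ i, z.1.par i ≠ i → w.1.par i ≠ i) ↔ z.1 ≤ w.1
    constructor
    · intro h
      refine le_iff.2 fun i => ⟨fun hi => ?_, fun hi => ?_⟩
      · rw [← (le_iff.1 z.2 i).1 hi, ← (le_iff.1 w.2 i).1 (h i hi)]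
      · by_cases hw : w.1.par i = i
        · rw [hw, hi]
        · rw [← (le_iff.1 w.2 i).1 hw]
          exact (le_iff.1 z.2 i).2 hi
    · intro h i hi
      rwa [(le_iff.1 h i).1 hi]

def downCongr (e : I ≃ J) {p : I → I} {q : J → J} (h : ∀ i, q (e i) = e (p i)) :
    Down p ≃o Down q where
  toFun N := ⟨e.symm ⁻¹' N.1, by
    have h' : ∀ j, e.symm (q j) = p (e.symm j) := fun j => by
      rw [e.symm_apply_eq, ← h, e.apply_symm_apply]
    refine ⟨fun j hj hq => N.2.1 _ hj ?_, fun j hj => N.2.2 _ ?_⟩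
    · rw [← h', hq]
    · rw [← h']
      exact hj⟩
  invFun N := ⟨e ⁻¹' N.1, by
    refine ⟨fun j hj hq => N.2.1 _ hj ?_, fun j hj => N.2.2 _ ?_⟩
    · rw [h, hq]
    · rw [h]
      exact hj⟩
  left_inv N := Subtype.ext (by simp [Set.preimage_preimage])
  right_inv N := Subtype.ext (by simp [Set.preimage_preimage])
  map_rel_iff' {M N} := by
    change e.symm ⁻¹' M.1 ⊆ e.symm ⁻¹' N.1 ↔ M.1 ⊆ N.1
    exact e.symm.surjective.preimage_subset_preimage_iff

def downPi (x : PiNAP I) : Down x.par ≃o ∀ u, Down (x.tree u).parent where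
  toFun N u := ⟨{i | i.1 ∈ N.1}, by
    refine ⟨fun i hi h => N.2.1 _ hi ?_, fun i hi => N.2.2 _ ?_⟩
    · rw [← tree_parent x u, h]
    · rw [← tree_parent x u]
      exact hi⟩
  invFun N := ⟨{i | (⟨i, rfl⟩ : {j // Quotient.mk x.part j = Quotient.mk x.part i}) ∈ (N (Quotient.mk x.part i)).1}, by
    refine ⟨fun i hi h => (N (Quotient.mk x.part i)).2.1 _ hi (Subtype.ext h), fun i hi => ?_⟩
    refine (N (Quotient.mk x.part i)).2.2 _ ?_
    have : ∀ (u : Quotient x.part) (h : Quotient.mk x.part (x.par i) = u),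
        (⟨x.par i, h⟩ : {j // Quotient.mk x.part j = u}) ∈ (N u).1 := by
      rintro u rfl
      exact hi
    exact this _ (x.mk_par i)⟩
  left_inv _ := rfl
  right_inv N := by
    funext u
    refine Subtype.ext (Set.ext fun i => ?_)
    obtain ⟨i, rfl⟩ := i
    rfl
  map_rel_iff' {M N} := by
    constructor
    · intro h i hi
      exact @h (Quotient.mk x.part i) ⟨i, rfl⟩ hi
    · intro h u i hi
      exact h hi

/-- The posets `[0̂, t]`, for the rooted trees `t ∈ NAP({0, …, n - 1})` and all `n`. -/
def Interval (a : Σ n, NAP (Fin n)) : Type := Set.Iic (ofTree a.2)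

noncomputable instance instPartialOrderInterval (a : Σ n, NAP (Fin n)) :
    PartialOrder (Interval a) := inferInstanceAs (PartialOrder (Set.Iic (ofTree a.2)))

noncomputable instance instBoundedOrderInterval (a : Σ n, NAP (Fin n)) :
    BoundedOrder (Interval a) := inferInstanceAs (BoundedOrder (Set.Iic (ofTree a.2)))

instance instFiniteInterval (a : Σ n, NAP (Fin n)) : Finite (Interval a) :=
  inferInstanceAs (Finite (Set.Iic (ofTree a.2)))

theorem down_interval [Finite I] (t : NAP I) :
    ∃ a : Σ n, NAP (Fin n), Nonempty (Down t.parent ≃o Interval a) := by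
  obtain ⟨n, ⟨e⟩⟩ := Finite.exists_equiv_fin I
  exact ⟨⟨n, t.relabel e⟩, ⟨(downCongr e fun i => by rw [par_ofTree]; simp [NAP.relabel]).trans
    (iicIso (ofTree (t.relabel e))).symm⟩⟩

def piCongrIso {U V : Type} (e : U ≃ V) {Q : U → Type} {R : V → Type} [∀ u, PartialOrder (Q u)]
    [∀ v, PartialOrder (R v)] (f : ∀ u, Q u ≃o R (e u)) : (∀ u, Q u) ≃o ∀ v, R v where
  toEquiv := e.piCongr fun u => (f u).toEquiv
  map_rel_iff' {a b} := by
    constructor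
    · intro h u
      have := h (e u)
      simpa using this
    · intro h v
      obtain ⟨u, rfl⟩ := e.surjective v
      simpa using h u

theorem exists_prd_pi {A : Type} (P : A → Type) [∀ a, PartialOrder (P a)] :
    ∀ (n : ℕ) (f : Fin n → A),
      ∃ l : List A, Nonempty ((∀ i, P (f i)) ≃o Incidence.Prd P l) := by
  intro n
  induction n with
  | zero =>
    intro f
    exact ⟨[], ⟨Incidence.uniqueIso (R := PUnit) (fun i => i.elim0) PUnit.unit⟩⟩
  | succ n ih =>
    intro f
    obtain ⟨l, ⟨e⟩⟩ := ih fun i => f i.succ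
    refine ⟨f 0 :: l, ⟨?_⟩⟩
    refine OrderIso.trans ?_ (Incidence.prodCongrIso (OrderIso.refl (P (f 0))) e)
    exact
      { toFun := fun g => (g 0, fun i => g i.succ)
        invFun := fun g => Fin.cons g.1 g.2
        left_inv := fun g => by
          funext i
          refine Fin.cases ?_ (fun i => ?_) i <;> simp
        right_inv := fun g => by simp
        map_rel_iff' := fun {a b} =>
          ⟨fun h i => Fin.cases h.1 h.2 i, fun h => ⟨h 0, fun i => h i.succ⟩⟩ }

theorem exists_iic [Finite I] (x : PiNAP I) :
    ∃ l : List (Σ n, NAP (Fin n)), Nonempty (Set.Iic x ≃o Incidence.Prd Interval l) := by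
  have : Finite (Quotient x.part) := inferInstance
  obtain ⟨n, ⟨e⟩⟩ := Finite.exists_equiv_fin (Quotient x.part)
  choose a ha using fun u => down_interval (x.tree u)
  obtain ⟨l, ⟨f⟩⟩ := exists_prd_pi Interval n fun i => a (e.symm i)
  refine ⟨l, ⟨(iicIso x).trans ((downPi x).trans (OrderIso.trans ?_ f))⟩⟩
  refine piCongrIso e fun u => ?_
  rw [e.symm_apply_apply]
  exact (ha u).some

theorem glue_le_glue (x : PiNAP I) (θ θ' : PiNAP (Quotient x.part)) :
    x.glue θ ≤ x.glue θ' ↔ θ ≤ θ' := by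
  have hinj : ∀ u v, x.rt u = x.rt v ↔ u = v := fun u v =>
    ⟨fun h => by rw [← x.mk_rt u, h, mk_rt], fun h => h ▸ rfl⟩
  have hp : ∀ (θ : PiNAP (Quotient x.part)) u, (x.glue θ).par (x.rt u) = x.rt (θ.par u) :=
    fun θ u => by rw [par_glue, if_pos (x.par_rt u), mk_rt]
  rw [le_iff, le_iff]
  constructor
  · intro h u
    have := h (x.rt u)
    simpa only [hp, ne_eq, hinj] using this
  · intro h i
    by_cases hi : x.par i = i
    · have hr := (x.par_eq_self_iff i).1 hi
      have := h (Quotient.mk x.part i)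
      rw [hr]
      simpa only [hp, ne_eq, hinj] using this
    · have h1 : ∀ θ, (x.glue θ).par i = x.par i := fun θ => by rw [par_glue, if_neg hi]
      rw [h1, h1]
      exact ⟨fun _ => rfl, fun h => absurd h hi⟩

/-- The final intervals. -/
noncomputable def iciIso {y : PiNAP I} (x : Set.Iic y) :
    Set.Ici x ≃o Set.Iic (Classical.choose (le_def.1 (show x.1 ≤ y from x.2))) :=
  have hθ := Classical.choose_spec (le_def.1 (show x.1 ≤ y from x.2))
  OrderIso.symm
    { toFun := fun η => ⟨⟨x.1.glue η.1,
          (((glue_le_glue _ _ _).2 η.2).trans_eq hθ : x.1.glue η.1 ≤ y)⟩,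
          (⟨η.1, rfl⟩ : x.1 ≤ x.1.glue η.1)⟩
      invFun := fun z => ⟨Classical.choose (le_def.1 (show x.1 ≤ z.1.1 from z.2)), by
        rw [Set.mem_Iic, ← glue_le_glue,
          Classical.choose_spec (le_def.1 (show x.1 ≤ z.1.1 from z.2)), hθ]
        exact z.1.2⟩
      left_inv := fun η => Subtype.ext (by
        have h := Classical.choose_spec
          (le_def.1 (show x.1 ≤ x.1.glue η.1 from ⟨η.1, rfl⟩))
        exact le_antisymm ((glue_le_glue _ _ _).1 h.le) ((glue_le_glue _ _ _).1 h.ge))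
      right_inv := fun z => Subtype.ext (Subtype.ext
        (Classical.choose_spec (le_def.1 (show x.1 ≤ z.1.1 from z.2))))
      map_rel_iff' := fun {a b} => glue_le_glue x.1 a.1 b.1 }

end PiNAP

/-- The good collection of the posets `[0̂, t]`, for the rooted trees `t`. -/
noncomputable def napFamily : Incidence.GoodFamily where
  A := Σ n, NAP (Fin n)
  P := PiNAP.Interval
  initial a x := by
    obtain ⟨l, ⟨e⟩⟩ := PiNAP.exists_iic (x : Set.Iic (PiNAP.ofTree a.2)).1
    exact ⟨l, ⟨(Incidence.iicIic (x : Set.Iic (PiNAP.ofTree a.2))).trans e⟩⟩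
  final a x := by
    obtain ⟨l, ⟨e⟩⟩ := PiNAP.exists_iic
      (Classical.choose (PiNAP.le_def.1 (show _ from (x : Set.Iic (PiNAP.ofTree a.2)).2)))
    exact ⟨l, ⟨(PiNAP.iciIso (x : Set.Iic (PiNAP.ofTree a.2))).trans e⟩⟩

instance instInFamIicNAP {I : Type} [Finite I] (x : PiNAP I) :
    Incidence.InFam napFamily (Set.Iic x) := ⟨PiNAP.exists_iic x⟩

/-- The incidence Hopf algebra of the operad `NAP`. -/
abbrev HNAP (K : Type*) [CommRing K] : Type _ := Incidence.Hopf napFamily K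

/-- The element `F_[t]`, where `[t]` is the isomorphism class of the poset `[0̂, t]`. -/
noncomputable def NAP.F (K : Type*) [CommRing K] {I : Type} [Finite I] (t : NAP I) : HNAP K :=
  Incidence.F napFamily K (Set.Iic (PiNAP.ofTree t))

/-- Planar rooted trees: `node n f` consists of a root joined to the roots of `f 0, …, f (n - 1)`. -/
inductive PTree : Type
  | node (n : ℕ) (f : Fin n → PTree) : PTree

namespace PTree

/-- Two planar trees are equivalent when they differ only in the order of the branches at the
vertices. -/
def Equivalent : PTree → PTree → Prop
  | node n f, node m g => ∃ σ : Fin n ≃ Fin m, ∀ i, Equivalent (f i) (g (σ i))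

theorem Equivalent.refl : ∀ t : PTree, Equivalent t t
  | node _ f => ⟨Equiv.refl _, fun i => Equivalent.refl (f i)⟩

theorem Equivalent.symm : ∀ {s t : PTree}, Equivalent s t → Equivalent t s
  | node _ f, node _ g, ⟨σ, h⟩ =>
    ⟨σ.symm, fun i => Equivalent.symm (by simpa using h (σ.symm i) : Equivalent (f _) (g i))⟩

theorem Equivalent.trans : ∀ {s t u : PTree}, Equivalent s t → Equivalent t u → Equivalent s u
  | node _ _, node _ _, node _ _, ⟨σ, h⟩, ⟨τ, h'⟩ =>
    ⟨σ.trans τ, fun i => (h i).trans (h' (σ i))⟩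

instance instSetoid : Setoid PTree where
  r := Equivalent
  iseqv := ⟨Equivalent.refl, Equivalent.symm, Equivalent.trans⟩

/-- The vertices of a planar tree. -/
def Vertex : PTree → Type
  | node n f => Option (Σ i : Fin n, Vertex (f i))

instance instFiniteVertex : ∀ t : PTree, Finite (Vertex t)
  | node n f =>
    have := fun i => instFiniteVertex (f i)
    inferInstanceAs (Finite (Option (Σ i : Fin n, Vertex (f i))))

/-- The underlying rooted tree, with labelled vertices. -/
noncomputable def toNAP : ∀ t : PTree, NAP (Vertex t)
  | node _ f => NAP.graft fun i => toNAP (f i)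

theorem Equivalent.exists_equiv : ∀ {s t : PTree}, Equivalent s t →
    ∃ e : Vertex s ≃ Vertex t, ∀ v, t.toNAP.parent (e v) = e (s.toNAP.parent v)
  | node n f, node m g, ⟨σ, h⟩ => by
    classical
    choose e he using fun i => (h i).exists_equiv
    have hr : ∀ i, e i (f i).toNAP.root = (g (σ i)).toNAP.root := fun i => by
      rw [← NAP.parent_eq_self_iff, he, NAP.parent_root]
    refine ⟨Equiv.optionCongr (Equiv.sigmaCongr σ e), ?_⟩
    rintro (_ | ⟨i, a⟩)
    · rfl
    · have h1 : e i a = (g (σ i)).toNAP.root ↔ a = (f i).toNAP.root := by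
        rw [← hr, (e i).apply_eq_iff_eq]
      change (if e i a = (g (σ i)).toNAP.root then none
          else some ⟨σ i, (g (σ i)).toNAP.parent (e i a)⟩ :
          Option (Σ j, Vertex (g j))) = (Equiv.optionCongr (Equiv.sigmaCongr σ e))
        (if a = (f i).toNAP.root then none else some ⟨i, (f i).toNAP.parent a⟩ :
          Option (Σ j, Vertex (f j)))
      by_cases ha : a = (f i).toNAP.root
      · rw [if_pos ha, if_pos (h1.2 ha)]
        rfl
      · rw [if_neg ha, if_neg fun h' => ha (h1.1 h'), he]
        rfl

end PTree

/-- Unlabelled rooted trees. -/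
def RTree : Type := Quotient PTree.instSetoid

namespace RTree

def mk (t : PTree) : RTree := Quotient.mk PTree.instSetoid t

theorem exists_equiv_of_map_eq {α : Type} {n m : ℕ} (f : Fin n → α) (g : Fin m → α)
    (h : Finset.univ.val.map f = Finset.univ.val.map g) :
    ∃ σ : Fin n ≃ Fin m, ∀ i, f i = g (σ i) := by
  classical
  have hc : ∀ a, Nonempty ({i // f i = a} ≃ {j // g j = a}) := fun a => by
    refine ⟨Fintype.equivOfCardEq ?_⟩
    have := congrArg (Multiset.count a) h
    rw [Multiset.count_map, Multiset.count_map] at this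
    simp only [Fintype.card_subtype, eq_comm (b := a)]
    exact this
  refine ⟨(Equiv.sigmaFiberEquiv f).symm.trans
    ((Equiv.sigmaCongrRight fun a => (hc a).some).trans (Equiv.sigmaFiberEquiv g)), fun i => ?_⟩
  exact ((hc (f i)).some ⟨i, rfl⟩).2.symm

theorem exists_rep (s : Multiset RTree) :
    ∃ t : PTree, ∃ n, ∃ f : Fin n → PTree, t = PTree.node n f ∧
      s = Finset.univ.val.map fun i => mk (f i) := by
  induction s using Quotient.inductionOn with
  | h l =>
  refine ⟨_, l.length, fun i => (l.get i).out, rfl, ?_⟩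
  have h : (fun i => mk (l.get i).out) = l.get := funext fun i => Quotient.out_eq _
  rw [h, Fin.univ_val_map, List.ofFn_get]
  rfl

/-- The rooted tree `B(r, t_1, …, t_k)`, for the multiset `{t_1, …, t_k}`. -/
noncomputable def node (s : Multiset RTree) : RTree := mk (exists_rep s).choose

theorem node_eq {n : ℕ} (f : Fin n → PTree) :
    node (Finset.univ.val.map fun i => mk (f i)) = mk (PTree.node n f) := by
  obtain ⟨m, g, hg, h⟩ := (exists_rep (Finset.univ.val.map fun i => mk (f i))).choose_spec
  rw [node, hg]
  obtain ⟨σ, hσ⟩ := exists_equiv_of_map_eq _ _ h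
  exact Eq.symm (Quotient.sound ⟨σ, fun i => Quotient.exact (hσ i)⟩)

theorem ind {p : RTree → Prop} (h : ∀ s : Multiset RTree, (∀ t ∈ s, p t) → p (node s))
    (t : RTree) : p t := by
  induction t using Quotient.inductionOn with
  | h t =>
  induction t with
  | node n f ih =>
    change p (mk (PTree.node n f))
    rw [← node_eq]
    refine h _ fun t ht => ?_
    obtain ⟨i, -, rfl⟩ := Multiset.mem_map.1 ht
    exact ih i

/-- The element `F_[t]` of the incidence Hopf algebra of `NAP`, for an unlabelled rooted tree
`t`. -/
noncomputable def F (K : Type*) [CommRing K] : RTree → HNAP K :=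
  Quotient.lift (fun t : PTree => t.toNAP.F K) fun s t h => by
    obtain ⟨e, he⟩ := PTree.Equivalent.exists_equiv h
    exact Incidence.F_eq napFamily K ((PiNAP.iicIso _).trans
      ((PiNAP.downCongr e he).trans (PiNAP.iicIso (PiNAP.ofTree t.toNAP)).symm))

end RTree

/-- The algebra underlying the Connes–Kreimer Hopf algebra: the free commutative algebra on the
unlabelled rooted trees. -/
def CK (K : Type*) [CommRing K] : Type _ := MvPolynomial RTree K

namespace CK

variable (K : Type*) [CommRing K]

noncomputable instance instCommRing : CommRing (CK K) :=
  inferInstanceAs (CommRing (MvPolynomial RTree K))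

noncomputable instance instAlgebra : Algebra K (CK K) :=
  inferInstanceAs (Algebra K (MvPolynomial RTree K))

/-- A rooted tree as a generator. -/
noncomputable def X (t : RTree) : CK K := (MvPolynomial.X t : MvPolynomial RTree K)

/-- The forest `t_1 ⋯ t_k`, the product of its trees. -/
noncomputable def forest (s : Multiset RTree) : CK K := (s.map (X K)).prod

/-- The morphism of algebras with given values on the rooted trees. -/
noncomputable def lift {A : Type*} [CommRing A] [Algebra K A] (f : RTree → A) : CK K →ₐ[K] A :=
  (MvPolynomial.aeval f : MvPolynomial RTree K →ₐ[K] A)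

theorem lift_X {A : Type*} [CommRing A] [Algebra K A] (f : RTree → A) (t : RTree) :
    lift K f (X K t) = f t := MvPolynomial.aeval_X f t

open Classical in
/-- The forests form a basis. -/
noncomputable def basis : Module.Basis (Multiset RTree) K (CK K) :=
  (MvPolynomial.basisMonomials RTree K).reindex Multiset.toFinsupp.symm.toEquiv

theorem basis_apply (s : Multiset RTree) : basis K s = forest K s := by
  classical
  have h : ∀ s : Multiset RTree,
      (MvPolynomial.monomial (Multiset.toFinsupp s) 1 : MvPolynomial RTree K) =
        (s.map MvPolynomial.X).prod := by
    intro s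
    induction s using Multiset.induction with
    | empty => simp
    | cons a s ih =>
      rw [Multiset.map_cons, Multiset.prod_cons, ← ih, ← Multiset.singleton_add, map_add,
        MvPolynomial.X, MvPolynomial.monomial_mul, Multiset.toFinsupp_singleton, one_mul]
  refine (Module.Basis.reindex_apply (MvPolynomial.basisMonomials RTree K) _ _).trans ?_
  convert! h s

/-- The linear map `B⁺`, which sends a forest `t_1 ⋯ t_k` to the tree `B(r, t_1, …, t_k)`. -/
noncomputable def Bplus : CK K →ₗ[K] CK K := (basis K).constr K fun s => X K (RTree.node s)

theorem Bplus_forest (s : Multiset RTree) : Bplus K (forest K s) = X K (RTree.node s) := by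
  rw [← basis_apply, Bplus, Module.Basis.constr_basis]


/-- The operator `id ⊗ B⁺`. -/
noncomputable def idB : CK K ⊗[K] CK K →ₗ[K] CK K ⊗[K] CK K := (Bplus K).lTensor (CK K)

/-- The coproduct of a tree: `Δ(B⁺(t_1 ⋯ t_k)) = B⁺(t_1 ⋯ t_k) ⊗ 1 + (id ⊗ B⁺)(Δ(t_1) ⋯ Δ(t_k))`. -/
noncomputable def comulPTree : PTree → CK K ⊗[K] CK K
  | PTree.node n f =>
    X K (RTree.mk (PTree.node n f)) ⊗ₜ[K] 1 + idB K (∏ i, comulPTree (f i))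

theorem comulPTree_eq : ∀ {s t : PTree}, PTree.Equivalent s t → comulPTree K s = comulPTree K t
  | PTree.node n f, PTree.node m g, ⟨σ, h⟩ => by
    rw [comulPTree, comulPTree, Fintype.prod_equiv σ _ (fun j => comulPTree K (g j)) fun i => comulPTree_eq (h i),
      show RTree.mk (PTree.node n f) = RTree.mk (PTree.node m g) from Quotient.sound ⟨σ, h⟩]

/-- The coproduct, as an algebra morphism. -/
noncomputable def comulHom : CK K →ₐ[K] CK K ⊗[K] CK K :=
  lift K (Quotient.lift (comulPTree K) fun _ _ h => comulPTree_eq K h)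

/-- The counit, as an algebra morphism: it vanishes on the trees. -/
noncomputable def counitHom : CK K →ₐ[K] K := lift K fun _ => 0

variable {K}

theorem linearMap_ext {M : Type*} [AddCommGroup M] [Module K M] {f g : CK K →ₗ[K] M}
    (h : ∀ s, f (forest K s) = g (forest K s)) : f = g :=
  (basis K).ext fun s => by rw [basis_apply, h]

/-- Two algebra morphisms agree if their values on `B⁺ x` are given by the same recursion. -/
theorem algHom_ext {A : Type*} [CommRing A] [Algebra K A] {φ ψ : CK K →ₐ[K] A}
    (h : ∀ x, φ x = ψ x → φ (Bplus K x) = ψ (Bplus K x)) : φ = ψ := by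
  have hX : ∀ t, φ (X K t) = ψ (X K t) := fun t => by
    induction t using RTree.ind with
    | h s ih =>
    rw [← Bplus_forest]
    refine h _ ?_
    rw [forest, map_multiset_prod, map_multiset_prod, Multiset.map_map, Multiset.map_map]
    exact congrArg _ (Multiset.map_congr rfl ih)
  exact MvPolynomial.algHom_ext (A := A) (f := (φ : MvPolynomial RTree K →ₐ[K] A)) hX

theorem forest_rep (n : ℕ) (f : Fin n → PTree) :
    forest K (Finset.univ.val.map fun i => RTree.mk (f i)) = ∏ i, X K (RTree.mk (f i)) := by
  rw [forest, Multiset.map_map]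
  rfl

theorem comulHom_Bplus (x : CK K) :
    comulHom K (Bplus K x) = Bplus K x ⊗ₜ[K] 1 + idB K (comulHom K x) := by
  have : (comulHom K).toLinearMap ∘ₗ Bplus K =
      (TensorProduct.mk K (CK K) (CK K)).flip 1 ∘ₗ Bplus K + idB K ∘ₗ (comulHom K).toLinearMap := by
    refine linearMap_ext fun s => ?_
    obtain ⟨-, n, f, -, rfl⟩ := RTree.exists_rep s
    change comulHom K (Bplus K _) = Bplus K _ ⊗ₜ[K] 1 + idB K (comulHom K _)
    rw [Bplus_forest, forest_rep, map_prod, RTree.node_eq]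
    have hX : ∀ t : PTree, comulHom K (X K (RTree.mk t)) = comulPTree K t := fun t => lift_X K _ _
    simp only [hX]
    exact comulPTree.eq_1 K n f
  exact LinearMap.congr_fun this x

theorem counitHom_Bplus (x : CK K) : counitHom K (Bplus K x) = 0 := by
  have : (counitHom K).toLinearMap ∘ₗ Bplus K = 0 := by
    refine linearMap_ext fun s => ?_
    change counitHom K (Bplus K _) = 0
    rw [Bplus_forest, counitHom, lift_X]
  exact LinearMap.congr_fun this x

theorem idB_tmul (x y : CK K) : idB K (x ⊗ₜ y) = x ⊗ₜ Bplus K y := rfl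

noncomputable instance instBialgebra : Bialgebra K (CK K) :=
  Bialgebra.ofAlgHom (comulHom K) (counitHom K)
    (by
      refine algHom_ext fun x hx => ?_
      have h1 : ∀ y : CK K ⊗[K] CK K, (Algebra.TensorProduct.assoc K K K (CK K) (CK K) (CK K))
          (Algebra.TensorProduct.map (comulHom K) (.id K (CK K)) (idB K y)) =
          (idB K).lTensor (CK K) (Algebra.TensorProduct.assoc K K K (CK K) (CK K) (CK K)
            (Algebra.TensorProduct.map (comulHom K) (.id K (CK K)) y)) := by
        intro y
        induction y using TensorProduct.induction_on with
        | zero => simp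
        | add y z hy hz => simp only [map_add, hy, hz]
        | tmul a b =>
          rw [idB_tmul, Algebra.TensorProduct.map_tmul, Algebra.TensorProduct.map_tmul]
          generalize comulHom K a = z
          induction z using TensorProduct.induction_on with
          | zero => simp
          | add y z hy hz => simp only [TensorProduct.add_tmul, map_add, hy, hz]
          | tmul c d => rfl
      have h2 : ∀ y : CK K ⊗[K] CK K,
          Algebra.TensorProduct.map (.id K (CK K)) (comulHom K) (idB K y) =
          Algebra.TensorProduct.assoc K K K (CK K) (CK K) (CK K) (idB K y ⊗ₜ 1) +
          (idB K).lTensor (CK K) (Algebra.TensorProduct.map (.id K (CK K)) (comulHom K) y) := by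
        intro y
        induction y using TensorProduct.induction_on with
        | zero => simp
        | add y z hy hz =>
          simp only [map_add, hy, hz, TensorProduct.add_tmul]
          abel
        | tmul a b =>
          rw [idB_tmul, Algebra.TensorProduct.map_tmul, Algebra.TensorProduct.map_tmul,
            comulHom_Bplus, TensorProduct.tmul_add]
          rfl
      have hx' : Algebra.TensorProduct.assoc K K K (CK K) (CK K) (CK K)
          (Algebra.TensorProduct.map (comulHom K) (.id K (CK K)) (comulHom K x)) =
          Algebra.TensorProduct.map (.id K (CK K)) (comulHom K) (comulHom K x) := hx
      change Algebra.TensorProduct.assoc K K K (CK K) (CK K) (CK K)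
          (Algebra.TensorProduct.map (comulHom K) (.id K (CK K)) (comulHom K (Bplus K x))) =
          Algebra.TensorProduct.map (.id K (CK K)) (comulHom K) (comulHom K (Bplus K x))
      rw [comulHom_Bplus, map_add, map_add, map_add, h1, h2, hx', Algebra.TensorProduct.map_tmul,
        Algebra.TensorProduct.map_tmul, comulHom_Bplus, TensorProduct.add_tmul, map_add, map_one,
        map_one, add_assoc]
      rfl)
    (by
      refine algHom_ext fun x hx => ?_
      have h1 : ∀ y : CK K ⊗[K] CK K,
          Algebra.TensorProduct.map (counitHom K) (.id K (CK K)) (idB K y) =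
          (Bplus K).lTensor K (Algebra.TensorProduct.map (counitHom K) (.id K (CK K)) y) := by
        intro y
        induction y using TensorProduct.induction_on with
        | zero => simp
        | add y z hy hz => simp only [map_add, hy, hz]
        | tmul a b => rfl
      have hx' : Algebra.TensorProduct.map (counitHom K) (.id K (CK K)) (comulHom K x) =
        (1 : K) ⊗ₜ[K] x := hx
      change Algebra.TensorProduct.map (counitHom K) (.id K (CK K)) (comulHom K (Bplus K x)) =
        (1 : K) ⊗ₜ[K] Bplus K x
      rw [comulHom_Bplus, map_add, h1, hx', Algebra.TensorProduct.map_tmul, counitHom_Bplus,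
        TensorProduct.zero_tmul, zero_add]
      rfl)
    (by
      refine algHom_ext fun x _ => ?_
      have h1 : ∀ y : CK K ⊗[K] CK K,
          Algebra.TensorProduct.map (.id K (CK K)) (counitHom K) (idB K y) = 0 := by
        intro y
        induction y using TensorProduct.induction_on with
        | zero => simp
        | add y z hy hz => simp only [map_add, hy, hz, add_zero]
        | tmul a b =>
          rw [idB_tmul, Algebra.TensorProduct.map_tmul, counitHom_Bplus, TensorProduct.tmul_zero]
      change Algebra.TensorProduct.map (.id K (CK K)) (counitHom K) (comulHom K (Bplus K x)) =
        Bplus K x ⊗ₜ[K] (1 : K)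
      rw [comulHom_Bplus, map_add, h1, add_zero, Algebra.TensorProduct.map_tmul, map_one]
      rfl)

theorem comul_eq (x : CK K) : Coalgebra.comul (R := K) x = comulHom K x := rfl

theorem counit_eq (x : CK K) : Coalgebra.counit (R := K) x = counitHom K x := rfl

variable (K)

/-- `(S ⊗ id) ∘ Δ` on the trees, where `S` is the antipode. -/
noncomputable def thetaPTree : PTree → CK K ⊗[K] CK K
  | PTree.node _ f =>
    idB K (∏ i, thetaPTree (f i)) - LinearMap.mul' K (CK K) (idB K (∏ i, thetaPTree (f i))) ⊗ₜ[K] 1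

theorem thetaPTree_eq : ∀ {s t : PTree}, PTree.Equivalent s t → thetaPTree K s = thetaPTree K t
  | PTree.node n f, PTree.node m g, ⟨σ, h⟩ => by
    rw [thetaPTree, thetaPTree, Fintype.prod_equiv σ _ (fun j => thetaPTree K (g j)) fun i => thetaPTree_eq (h i)]

/-- `(S ⊗ id) ∘ Δ`, where `S` is the antipode. -/
noncomputable def theta : CK K →ₐ[K] CK K ⊗[K] CK K :=
  lift K (Quotient.lift (thetaPTree K) fun _ _ h => thetaPTree_eq K h)

/-- The antipode, as an algebra morphism. -/
noncomputable def antipodeHom : CK K →ₐ[K] CK K :=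
  (Algebra.TensorProduct.rid K K (CK K)).toAlgHom.comp
    ((Algebra.TensorProduct.map (.id K (CK K)) (counitHom K)).comp (theta K))

variable {K}

theorem theta_Bplus (x : CK K) :
    theta K (Bplus K x) = idB K (theta K x) -
      LinearMap.mul' K (CK K) (idB K (theta K x)) ⊗ₜ[K] 1 := by
  have : (theta K).toLinearMap ∘ₗ Bplus K =
      idB K ∘ₗ (theta K).toLinearMap - (TensorProduct.mk K (CK K) (CK K)).flip 1 ∘ₗ
        LinearMap.mul' K (CK K) ∘ₗ idB K ∘ₗ (theta K).toLinearMap := by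
    refine linearMap_ext fun s => ?_
    obtain ⟨-, n, f, -, rfl⟩ := RTree.exists_rep s
    change theta K (Bplus K _) = idB K (theta K _) -
      LinearMap.mul' K (CK K) (idB K (theta K _)) ⊗ₜ[K] 1
    rw [Bplus_forest, forest_rep, map_prod, RTree.node_eq]
    have hX : ∀ t : PTree, theta K (X K (RTree.mk t)) = thetaPTree K t := fun t => lift_X K _ _
    simp only [hX]
    exact thetaPTree.eq_1 K n f
  exact LinearMap.congr_fun this x

theorem antipodeHom_Bplus (x : CK K) :
    antipodeHom K (Bplus K x) = -LinearMap.mul' K (CK K) (idB K (theta K x)) := by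
  have h1 : ∀ y : CK K ⊗[K] CK K,
      Algebra.TensorProduct.map (.id K (CK K)) (counitHom K) (idB K y) = 0 := by
    intro y
    induction y using TensorProduct.induction_on with
    | zero => simp
    | add y z hy hz => simp only [map_add, hy, hz, add_zero]
    | tmul a b =>
      rw [idB_tmul, Algebra.TensorProduct.map_tmul, counitHom_Bplus, TensorProduct.tmul_zero]
  change Algebra.TensorProduct.rid K K (CK K)
    (Algebra.TensorProduct.map (.id K (CK K)) (counitHom K) (theta K (Bplus K x))) = _
  rw [theta_Bplus, map_sub, h1, Algebra.TensorProduct.map_tmul, zero_sub, map_neg, map_one]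
  simp

theorem theta_eq (x : CK K) :
    theta K x = Algebra.TensorProduct.map (antipodeHom K) (.id K (CK K)) (comulHom K x) := by
  have : theta K =
      (Algebra.TensorProduct.map (antipodeHom K) (.id K (CK K))).comp (comulHom K) := by
    refine algHom_ext fun x hx => ?_
    have h1 : ∀ y : CK K ⊗[K] CK K,
        Algebra.TensorProduct.map (antipodeHom K) (.id K (CK K)) (idB K y) =
          idB K (Algebra.TensorProduct.map (antipodeHom K) (.id K (CK K)) y) := by
      intro y
      induction y using TensorProduct.induction_on with
      | zero => simp
      | add y z hy hz => simp only [map_add, hy, hz]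
      | tmul a b => rfl
    rw [AlgHom.comp_apply] at hx
    rw [AlgHom.comp_apply, comulHom_Bplus, map_add, h1, ← hx, theta_Bplus,
      Algebra.TensorProduct.map_tmul, antipodeHom_Bplus, TensorProduct.neg_tmul, map_one]
    abel
  exact AlgHom.congr_fun this x

theorem mul_theta (x : CK K) :
    LinearMap.mul' K (CK K) (theta K x) = algebraMap K (CK K) (counitHom K x) := by
  have : (Algebra.TensorProduct.lmul' K (S := CK K)).comp (theta K) =
      (Algebra.ofId K (CK K)).comp (counitHom K) := by
    refine algHom_ext fun x _ => ?_
    change LinearMap.mul' K (CK K) (theta K (Bplus K x)) =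
      algebraMap K (CK K) (counitHom K (Bplus K x))
    rw [theta_Bplus, counitHom_Bplus, map_sub, map_zero, LinearMap.mul'_apply, mul_one, sub_self]
  exact AlgHom.congr_fun this x

noncomputable instance instHopfAlgebra : HopfAlgebra K (CK K) := by
  have h1 : WithConv.toConv (antipodeHom K).toLinearMap *
      WithConv.toConv (LinearMap.id (R := K) (M := CK K)) = 1 := by
    refine WithConv.ext (LinearMap.ext fun x => ?_)
    change LinearMap.mul' K (CK K)
      (Algebra.TensorProduct.map (antipodeHom K) (.id K (CK K)) (comulHom K x)) =
        algebraMap K (CK K) (counitHom K x)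
    rw [← theta_eq, mul_theta]
  have h2 : WithConv.toConv ((antipodeHom K).toLinearMap ∘ₗ (antipodeHom K).toLinearMap) *
      WithConv.toConv (antipodeHom K).toLinearMap = 1 := by
    have h := LinearMap.algHom_comp_convMul_distrib (antipodeHom K)
      (WithConv.toConv (antipodeHom K).toLinearMap)
      (WithConv.toConv (LinearMap.id (R := K) (M := CK K)))
    rw [h1] at h
    refine WithConv.ext (h.symm.trans (LinearMap.ext fun x => ?_))
    exact (antipodeHom K).commutes _
  have h3 := left_inv_eq_right_inv h2 h1
  exact HopfAlgebra.ofConvInverse (antipodeHom K).toLinearMap h1 (by rw [← h3]; exact h2)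

end CK

section Cocycle

variable {K : Type*} [CommRing K]

/-- `Δ(L x) = L x ⊗ 1 + (id ⊗ L)(Δ x)`: the map `L` is a Hochschild 1-cocycle. -/
def IsCocycle {H : Type*} [CommRing H] [HopfAlgebra K H] (L : H →ₗ[K] H) : Prop :=
  ∀ x : H, Coalgebra.comul (R := K) (L x) =
    L x ⊗ₜ[K] (1 : H) + L.lTensor H (Coalgebra.comul (R := K) x)

/-- `(H, L)` is universal among the commutative Hopf algebras with a 1-cocycle. -/
def IsUniversalCocycle.{w, v, u} {K : Type u} [CommRing K] {H : Type v} [CommRing H]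
    [HopfAlgebra K H] (L : H →ₗ[K] H) : Prop :=
  IsCocycle L ∧
    ∀ (H' : Type w) [CommRing H'] [HopfAlgebra K H'] (L' : H' →ₗ[K] H'), IsCocycle L' →
      ∃! φ : H →ₐc[K] H', ∀ x : H, φ (L x) = L' (φ x)

end Cocycle

universe w u

/-! The interval below a rooted tree has a recursive shape. An element below `t` is determined by
its set of non-root vertices, which is closed under passing to descendants and avoids the root of
`t`. For `t = B(r, t_1, …, t_k)` such a set is chosen independently on the branches: on `t_i` it is
either a set of the same kind for `t_i`, or, if it contains the root of `t_i`, all of `t_i`. Hence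
the interval of `t` is the product of the intervals of the `t_i`, each with a new greatest element
(`PiNAP.downGraft`).

Three consequences carry the theorem. With one branch, passing from `t` to `B(r, t)` adds a greatest
element to the interval; as this depends only on the isomorphism class, it defines a linear map `L`,
and splitting the coproduct sum into the new element and the old ones gives the cocycle identity
(`HNAP.isCocycle_L`). With several branches, `F` of `B(r, t_1, …, t_k)` is the product of the `F` of
the `B(r, t_i)` (`HNAP.F_node`), so every finite product of intervals is again the interval of one
tree, obtained by merging roots (`RTree.cls_surjective`). Finally, the factors `WithTop (A i)` of a
product can be recovered from its order (`exists_equiv_of_pi_withTop`), so by recursion the interval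
determines the unlabelled tree (`RTree.cls_injective`). The classes of intervals are therefore in
bijection with rooted trees, and the `F_[t]` form a basis.

On the other side, `B⁺` is universal because the trees are generated from the unit by products and
`B⁺`: an intertwining algebra morphism is prescribed recursively, and the cocycle identity of the
target makes it compatible with the coproducts. Applied to `L`, this gives a morphism from the
Connes–Kreimer algebra to `HNAP K`. By induction it sends the forest `t_1 ⋯ t_k` to `F` of `B(r,
t_1, …, t_k)`, so it carries a basis bijectively to a basis and is an isomorphism. Universality of
`L` and uniqueness of the isomorphism are transported along it. -/

/-! ### Recovering the factors of a product of posets with added greatest elements -/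

section Order

variable {ι κ : Type} {A : ι → Type} {B : κ → Type} [∀ i, PartialOrder (A i)]
  [∀ j, PartialOrder (B j)] [∀ i, BoundedOrder (A i)] [∀ j, BoundedOrder (B j)]

/-- The element `x` has a greatest strict predecessor. -/
def HasPred {Q : Type} [PartialOrder Q] (x : Q) : Prop := ∃ c, IsGreatest (Set.Iio x) c

theorem HasPred.map {Q R : Type} [PartialOrder Q] [PartialOrder R] (φ : Q ≃o R) {x : Q}
    (h : HasPred x) : HasPred (φ x) := by
  obtain ⟨c, hc, hc'⟩ := h
  refine ⟨φ c, φ.lt_iff_lt.2 hc, fun y hy => ?_⟩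
  rw [← φ.symm_apply_le]
  exact hc' (φ.symm_apply_lt.2 hy)

theorem maximal_hasPred_map {Q R : Type} [PartialOrder Q] [PartialOrder R] (φ : Q ≃o R) {x : Q}
    (h : Maximal HasPred x) : Maximal HasPred (φ x) := by
  refine ⟨h.1.map φ, fun y hy hxy => ?_⟩
  rw [← φ.le_symm_apply] at hxy
  rw [← φ.symm_apply_le]
  exact h.2 (hy.map φ.symm) hxy

open Classical in
/-- The greatest element of a factor, as an element of the product. -/
noncomputable def factorTop (A : ι → Type) [∀ i, PartialOrder (A i)] [∀ i, BoundedOrder (A i)]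
    (i : ι) : ∀ i, WithTop (A i) := Function.update ⊥ i ⊤

theorem le_factorTop_iff {i : ι} {x : ∀ i, WithTop (A i)} :
    x ≤ factorTop A i ↔ ∀ k, k ≠ i → x k = ⊥ := by
  classical
  rw [factorTop, le_update_iff]
  simp [le_bot_iff]

theorem factorTop_injective : Function.Injective (factorTop A) := by
  intro i k h
  by_contra hik
  have h1 := le_factorTop_iff.1 h.le i hik
  simp [factorTop] at h1

open Classical in
/-- The elements strictly below the greatest element of a factor. -/
noncomputable def iioFactorTop (i : ι) : A i ≃o Set.Iio (factorTop A i) :=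
  RelIso.ofSurjective
    (OrderEmbedding.ofMapLEIff
      (fun a => (⟨Function.update ⊥ i (a : WithTop (A i)), by
        rw [Set.mem_Iio, factorTop, update_lt_update_iff]
        exact WithTop.coe_lt_top a⟩ : Set.Iio (factorTop A i)))
      fun a b => by
        rw [Subtype.mk_le_mk, update_le_update_iff]
        simp)
    (by
      rintro ⟨y, hy⟩
      have hy : y < factorTop A i := hy
      have h1 := le_factorTop_iff.1 hy.le
      have h2 : y i ≠ ⊤ := fun h => hy.not_ge (by
        rw [factorTop, update_le_iff]
        exact ⟨h.ge, fun _ _ => bot_le⟩)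
      obtain ⟨a, ha⟩ := WithTop.ne_top_iff_exists.1 h2
      refine ⟨a, Subtype.ext (funext fun k => ?_)⟩
      change (Function.update ⊥ i (a : WithTop (A i)) : ∀ i, WithTop (A i)) k = y k
      by_cases hk : k = i
      · subst hk
        simpa using ha
      · simp [hk, h1 k hk])

/-- The strict predecessors form a copy of `A i`, which has a greatest element because `A i` is
bounded. -/
theorem hasPred_factorTop (i : ι) : HasPred (factorTop A i) :=
  ⟨(iioFactorTop i ⊤).1, (iioFactorTop i ⊤).2, fun y hy => by
    have : (⟨y, hy⟩ : Set.Iio (factorTop A i)) ≤ iioFactorTop i ⊤ := by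
      rw [← OrderIso.symm_apply_le]
      exact le_top
    exact this⟩

/-- Only one coordinate of `x` can differ from `⊥`. If two did, lowering either of them to `⊥` would
give an element strictly below `x`, hence below the greatest strict predecessor `c`; the join of
these two elements is `x`, so `x ≤ c`, which is absurd. Some coordinate does differ from `⊥`, since
nothing lies strictly below the least element. -/
theorem HasPred.exists_le_factorTop {x : ∀ i, WithTop (A i)} (h : HasPred x) :
    ∃ i, x ≤ factorTop A i := by
  classical
  obtain ⟨c, hc, hc'⟩ := h
  have hc : c < x := hc
  obtain ⟨i, hi⟩ : ∃ i, x i ≠ ⊥ := by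
    by_contra! h
    exact (hc.trans_le (fun i => (h i).le.trans bot_le : x ≤ c)).false
  refine ⟨i, le_factorTop_iff.2 fun k hk => ?_⟩
  by_contra hxk
  have key : ∀ l, x l ≠ ⊥ → Function.update x l ⊥ ≤ c := fun l hl =>
    hc' (update_lt_self_iff.2 (bot_lt_iff_ne_bot.2 hl))
  refine (hc.trans_le fun l => ?_).false
  by_cases hl : l = i
  · subst hl
    simpa [hk.symm] using key k hxk l
  · simpa [hl] using key i hi l

/-- This characterizes the elements `factorTop A i` by the order alone, so that any order
isomorphism must permute them. Distinct ones are incomparable, hence each is maximal among the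
elements with a greatest strict predecessor. -/
theorem maximal_hasPred_iff {x : ∀ i, WithTop (A i)} :
    Maximal HasPred x ↔ ∃ i, factorTop A i = x := by
  constructor
  · intro h
    obtain ⟨i, hi⟩ := h.1.exists_le_factorTop
    exact ⟨i, le_antisymm (h.2 (hasPred_factorTop i) hi) hi⟩
  · rintro ⟨i, rfl⟩
    refine ⟨hasPred_factorTop i, fun y hy hiy => ?_⟩
    obtain ⟨k, hk⟩ := hy.exists_le_factorTop
    obtain rfl : i = k := by
      by_contra hik
      have h1 := le_factorTop_iff.1 (hiy.trans hk) i hik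
      simp [factorTop] at h1
    exact hk

/-- The factors of a product of bounded posets with a new greatest element are determined by the
product. -/
theorem exists_equiv_of_pi_withTop
    (φ : (∀ i, WithTop (A i)) ≃o ∀ j, WithTop (B j)) :
    ∃ σ : ι ≃ κ, ∀ i, Nonempty (A i ≃o B (σ i)) := by
  -- The isomorphism maps the order-theoretically distinguished elements to each other, which
  -- matches the indices.
  have h1 : ∀ i, ∃ j, factorTop B j = φ (factorTop A i) := fun i =>
    maximal_hasPred_iff.1 (maximal_hasPred_map φ (maximal_hasPred_iff.2 ⟨i, rfl⟩))
  choose f hf using h1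
  have hbij : Function.Bijective f := by
    constructor
    · intro i k h
      refine factorTop_injective (A := A) (φ.injective ?_)
      rw [← hf, ← hf, h]
    · intro j
      obtain ⟨i, hi⟩ := maximal_hasPred_iff.1
        (maximal_hasPred_map φ.symm (maximal_hasPred_iff.2 ⟨j, rfl⟩))
      refine ⟨i, factorTop_injective (A := B) ?_⟩
      rw [hf, hi, OrderIso.apply_symm_apply]
  refine ⟨Equiv.ofBijective f hbij, fun i => ⟨?_⟩⟩
  -- The isomorphism restricts to the strict predecessors of matching elements, and these are copies
  -- of the factors without their added greatest elements.
  have e : Set.Iio (factorTop A i) ≃o Set.Iio (factorTop B (f i)) :=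
    { toEquiv := φ.toEquiv.subtypeEquiv fun a => by simp [hf]
      map_rel_iff' := fun {a b} => by
        rcases a with ⟨a, _⟩
        rcases b with ⟨b, _⟩
        simp [Equiv.subtypeEquiv] }
  exact (iioFactorTop i).trans (e.trans (iioFactorTop (f i)).symm)

end Order

/-! ### The interval of a grafted tree -/

namespace PiNAP

variable {I : Type}

instance instBoundedOrderDown (t : NAP I) : BoundedOrder (Down t.parent) where
  bot := ⟨∅, by simp, by simp⟩
  bot_le N := Set.empty_subset N.1
  top := ⟨{i | t.parent i ≠ i}, fun _ hi => hi, fun i hi h => hi (congrArg t.parent h)⟩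
  le_top N := N.2.1

/-- Membership in a set of vertices, with an additional set that contains all of them. -/
def WithTopMem {p : I → I} (i : I) (M : WithTop (Down p)) : Prop := ∀ N : Down p, M = N → i ∈ N.1

theorem withTopMem_top {p : I → I} (i : I) : WithTopMem i (⊤ : WithTop (Down p)) :=
  fun _ h => absurd h WithTop.top_ne_coe

theorem withTopMem_coe {p : I → I} (i : I) (N : Down p) :
    WithTopMem i (N : WithTop (Down p)) ↔ i ∈ N.1 :=
  ⟨fun h => h N rfl, fun h M hM => by rwa [← WithTop.coe_injective hM]⟩

/-- With the added element read as the set of all vertices, the order of `WithTop` is inclusion. The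
added element stays strictly above the others because no member of `Down t.parent` contains the
root. -/
theorem withTop_le_iff {t : NAP I} {M M' : WithTop (Down t.parent)} :
    M ≤ M' ↔ ∀ i, WithTopMem i M → WithTopMem i M' := by
  induction M' using WithTop.recTopCoe with
  | top => simp [withTopMem_top]
  | coe N' =>
    induction M using WithTop.recTopCoe with
    | top =>
      refine iff_of_false (by simp) fun h => ?_
      exact N'.2.1 _ ((withTopMem_coe _ _).1 (h t.root (withTopMem_top _))) t.parent_root
    | coe N =>
      simp only [withTopMem_coe, WithTop.coe_le_coe]
      exact Iff.rfl

section Graft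

variable {ι : Type} {J : ι → Type} (t : ∀ i, NAP (J i))

theorem graft_parent_root (i : ι) : (NAP.graft t).parent (some ⟨i, (t i).root⟩) = none :=
  if_pos rfl

theorem graft_parent_of_ne {i : ι} {a : J i} (ha : a ≠ (t i).root) :
    (NAP.graft t).parent (some ⟨i, a⟩) = some ⟨i, (t i).parent a⟩ := if_neg ha

/-- The set `N` is closed under descendants, and every vertex of the branch descends from its root.
This is why containing the root of a branch is a single extra option, encoded by `⊤` in
`graftRestrict`. -/
theorem graft_mem_of_root_mem (N : Down (NAP.graft t).parent) {i : ι}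
    (hi : some ⟨i, (t i).root⟩ ∈ N.1) (a : J i) : some ⟨i, a⟩ ∈ N.1 := by
  obtain ⟨n, hn⟩ := (t i).reach a
  induction n generalizing a with
  | zero => rwa [show a = _ from hn]
  | succ n ih =>
    by_cases ha : a = (t i).root
    · rwa [ha]
    · exact N.2.2 _ (by rw [graft_parent_of_ne t ha]; exact ih _ hn)

open Classical in
/-- The part of a set of vertices of `B(r, t_1, …, t_k)` that lies in `t_i`. -/
noncomputable def graftRestrict (N : Down (NAP.graft t).parent) (i : ι) :
    WithTop (Down (t i).parent) :=
  if h : some ⟨i, (t i).root⟩ ∈ N.1 then ⊤ else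
    WithTop.some (⟨{a | some ⟨i, a⟩ ∈ N.1}, by
      constructor
      · intro a ha hp
        rw [(t i).parent_eq_self_iff] at hp
        subst hp
        exact h ha
      · intro a ha
        by_cases hr : a = (t i).root
        · subst hr
          exact absurd (by simpa [(t i).parent_root] using ha) h
        · exact N.2.2 _ (by rw [graft_parent_of_ne t hr]; exact ha)⟩ : Down (t i).parent)

theorem withTopMem_graftRestrict (N : Down (NAP.graft t).parent) (i : ι) (a : J i) :
    WithTopMem a (graftRestrict t N i) ↔ some ⟨i, a⟩ ∈ N.1 := by
  rw [graftRestrict]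
  split_ifs with h
  · exact iff_of_true (withTopMem_top a) (graft_mem_of_root_mem t N h a)
  · exact withTopMem_coe a _

/-- The interval `[0̂, B(r, t_1, …, t_k)]` is the product of the intervals `[0̂, t_i]`, each with a
new greatest element. -/
noncomputable def downGraft :
    Down (NAP.graft t).parent ≃o ∀ i, WithTop (Down (t i).parent) :=
  RelIso.ofSurjective
    (OrderEmbedding.ofMapLEIff (graftRestrict t) fun N M => by
      simp only [Pi.le_def, withTop_le_iff, withTopMem_graftRestrict]
      constructor
      · rintro h (_ | ⟨i, a⟩) hx
        -- The new root lies in no admissible set, so the branches see every member of `N`.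
        · exact absurd (NAP.graft t).parent_root (N.2.1 _ hx)
        · exact h i a hx
      · exact fun h i a ha => h ha)
    (by
      intro g
      have hmem : ∀ i a, (∃ k b, (some ⟨i, a⟩ : Option (Σ i, J i)) = some ⟨k, b⟩ ∧
          WithTopMem b (g k)) ↔ WithTopMem a (g i) := fun i a => by
        constructor
        · rintro ⟨k, b, h, hb⟩
          simp only [Option.some.injEq, Sigma.mk.injEq] at h
          obtain ⟨rfl, h⟩ := h
          obtain rfl := eq_of_heq h
          exact hb
        · exact fun h => ⟨i, a, rfl, h⟩
      -- The preimage of `g` is the union over the branches of the vertex sets encoded by the `g i`.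
      -- Admissibility is checked branch by branch: the root of a branch has the new root as its
      -- parent, so it may belong to the set without violating either condition.
      refine ⟨⟨{x | ∃ i a, x = some ⟨i, a⟩ ∧ WithTopMem a (g i)}, ?_, ?_⟩, ?_⟩
      · rintro _ ⟨i, a, rfl, ha⟩ hx
        by_cases hr : a = (t i).root
        · subst hr
          rw [graft_parent_root] at hx
          cases hx
        · rw [graft_parent_of_ne t hr] at hx
          simp only [Option.some.injEq, Sigma.mk.injEq, heq_eq_eq, true_and] at hx
          exact hr (((t i).parent_eq_self_iff a).1 hx)
      · rintro (_ | ⟨i, a⟩) hx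
        · obtain ⟨k, b, hx, hb⟩ := hx
          cases hx
        · refine (hmem i a).2 ?_
          by_cases hr : a = (t i).root
          · obtain ⟨k, b, hx, hb⟩ := hx
            subst hr
            rw [graft_parent_root] at hx
            cases hx
          · rw [graft_parent_of_ne t hr] at hx
            have hb : WithTopMem ((t i).parent a) (g i) := (hmem i _).1 hx
            generalize g i = M at hb
            induction M using WithTop.recTopCoe with
            | top => exact withTopMem_top a
            | coe N =>
              rw [withTopMem_coe] at hb ⊢
              exact N.2.2 _ hb
      · funext i
        refine le_antisymm (withTop_le_iff.2 fun a ha => ?_) (withTop_le_iff.2 fun a ha => ?_)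
        · exact (hmem i a).1 ((withTopMem_graftRestrict t _ i a).1 ha)
        · exact (withTopMem_graftRestrict t _ i a).2 ((hmem i a).2 ha))

end Graft

end PiNAP

/-! ### A tree is determined by its interval -/

namespace PTree

/-- The interval `[0̂, t]`, described by sets of vertices. -/
abbrev Lat (t : PTree) : Type := PiNAP.Down t.toNAP.parent

/-- This turns structural recursion on planar trees into recursion on their intervals. -/
noncomputable def latNode {n : ℕ} (f : Fin n → PTree) :
    Lat (node n f) ≃o ∀ i, WithTop (Lat (f i)) :=
  PiNAP.downGraft fun i => (f i).toNAP

/-- A rooted tree is determined by its interval. -/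
theorem equivalent_of_lat : ∀ {s t : PTree}, (Lat s ≃o Lat t) → Equivalent s t
  | node n f, node m g, φ => by
    -- Both intervals are products of branch intervals with added greatest elements, so the branches
    -- are matched up to isomorphism of their intervals, and the recursion applies to each pair.
    obtain ⟨σ, h⟩ := exists_equiv_of_pi_withTop
      ((latNode f).symm.trans (φ.trans (latNode g)))
    exact ⟨σ, fun i => equivalent_of_lat (h i).some⟩

end PTree

/-! ### Decomposition of a labelled tree at its root -/

namespace NAP

variable {I : Type}

open Classical in
/-- The subtree of the descendants of a vertex. -/
noncomputable def sub (t : NAP I) (c : I) : NAP {j : I // ∃ n, t.parent^[n] j = c} where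
  root := ⟨c, 0, rfl⟩
  parent j := if h : j.1 = c then j else ⟨t.parent j.1, by
    obtain ⟨j, n, hn⟩ := j
    cases n with
    | zero => exact absurd hn h
    | succ n => exact ⟨n, hn⟩⟩
  parent_root := dif_pos rfl
  reach := by
    rintro ⟨j, n, hn⟩
    induction n generalizing j with
    | zero => exact ⟨0, Subtype.ext hn⟩
    | succ n ih =>
      by_cases h : j = c
      · exact ⟨0, Subtype.ext h⟩
      · obtain ⟨m, hm⟩ := ih (t.parent j) hn
        exact ⟨m + 1, by rw [Function.iterate_succ_apply, dif_neg h]; exact hm⟩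

/-- The children of the root. -/
def Child (t : NAP I) : Type := {c : I // t.parent c = t.root ∧ c ≠ t.root}

instance [Finite I] (t : NAP I) : Finite t.Child := inferInstanceAs (Finite (Subtype _))

/-- If `j` climbs to `c` no later than to `d`, then `d` is reached by climbing from `c`. Beyond the
child `c` there is only the root, which is not a child, so no step is taken and `c = d`. Hence the
subtrees of distinct children are disjoint. -/
theorem child_unique_of_le (t : NAP I) (c d : t.Child) {j : I} {m n : ℕ} (hmn : m ≤ n)
    (hm : t.parent^[m] j = c.1) (hn : t.parent^[n] j = d.1) : c = d := by
  obtain ⟨k, rfl⟩ := Nat.exists_eq_add_of_le' hmn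
  rw [Function.iterate_add_apply, hm] at hn
  cases k with
  | zero => exact Subtype.ext hn
  | succ k =>
    rw [Function.iterate_succ_apply, c.2.1, Function.iterate_fixed t.parent_root] at hn
    exact absurd hn.symm d.2.2

/-- The vertices of a rooted tree are its root and the vertices of the subtrees of the children of
the root. -/
theorem graft_sub_bijective (t : NAP I) : Function.Bijective
    (fun x : Option (Σ c : t.Child, {j : I // ∃ n, t.parent^[n] j = c.1}) =>
      x.elim t.root fun p => p.2.1) := by
  have hr : ∀ (c : t.Child) n, t.parent^[n] t.root ≠ c.1 := fun c n h => by
    rw [Function.iterate_fixed t.parent_root] at h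
    exact c.2.2 h.symm
  constructor
  · rintro (_ | ⟨c, j, m, hm⟩) (_ | ⟨d, k, n, hn⟩) h
    · rfl
    · have h : t.root = k := h
      subst h
      exact absurd hn (hr d n)
    · have h : j = t.root := h
      subst h
      exact absurd hm (hr c m)
    · have h : j = k := h
      subst h
      have hcd : c = d := by
        rcases le_total m n with hmn | hmn
        · exact t.child_unique_of_le c d hmn hm hn
        · exact (t.child_unique_of_le d c hmn hn hm).symm
      subst hcd
      rfl
  · intro j
    obtain ⟨n, hn⟩ := t.reach j
    induction n generalizing j with
    | zero => exact ⟨none, hn.symm⟩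
    | succ n ih =>
      -- If the parent of `j` is the root, then `j` is the root or a child; otherwise `j` lies in
      -- the same subtree as its parent.
      obtain ⟨_ | ⟨c, k, m, hm⟩, hx⟩ := ih (t.parent j) hn
      · by_cases hj : j = t.root
        · exact ⟨none, hj.symm⟩
        · exact ⟨some ⟨⟨j, hx.symm, hj⟩, j, 0, rfl⟩, rfl⟩
      · have hx : k = t.parent j := hx
        subst hx
        exact ⟨some ⟨c, j, m + 1, hm⟩, rfl⟩

/-- The interval `[0̂, t]` in terms of the subtrees of the children of the root. -/
noncomputable def downSub (t : NAP I) :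
    PiNAP.Down t.parent ≃o ∀ c : t.Child, WithTop (PiNAP.Down (t.sub c.1).parent) :=
  ((PiNAP.downCongr (Equiv.ofBijective _ t.graft_sub_bijective)
    (p := (graft fun c : t.Child => t.sub c.1).parent) (q := t.parent) (by
      rintro (_ | ⟨c, j⟩)
      · exact t.parent_root
      · by_cases h : j = (t.sub c.1).root
        · have h1 : (graft fun c : t.Child => t.sub c.1).parent (some ⟨c, j⟩) = none := if_pos h
          rw [h1, h]
          exact c.2.1
        · have h1 : (graft fun c : t.Child => t.sub c.1).parent (some ⟨c, j⟩) =
            some ⟨c, (t.sub c.1).parent j⟩ := if_neg h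
          rw [h1]
          have h2 : (t.sub c.1).parent j = ⟨t.parent j.1, _⟩ := dif_neg fun h' => h (Subtype.ext h')
          exact (congrArg Subtype.val h2).symm)).symm).trans
    (PiNAP.downGraft fun c : t.Child => t.sub c.1)

/-- The interval of a labelled rooted tree is the interval of a planar tree. -/
theorem exists_lat [Finite I] (t : NAP I) :
    ∃ s : PTree, Nonempty (PiNAP.Down t.parent ≃o s.Lat) := by
  induction hN : Nat.card I using Nat.strong_induction_on generalizing I with
  | _ N ih =>
  have h1 : ∀ c : t.Child, ∃ s : PTree, Nonempty (PiNAP.Down (t.sub c.1).parent ≃o s.Lat) :=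
    -- The induction is on the number of vertices: the root does not climb to the child `c`, so the
    -- subtree at `c` is strictly smaller.
    fun c => ih _ (by
      rw [← hN]
      refine Finite.card_subtype_lt (x := t.root) ?_
      rintro ⟨n, hn⟩
      rw [Function.iterate_fixed t.parent_root] at hn
      exact c.2.2 hn.symm) (t.sub c.1) rfl
  choose s hs using h1
  obtain ⟨k, ⟨e⟩⟩ := Finite.exists_equiv_fin t.Child
  refine ⟨PTree.node k fun i => s (e.symm i), ⟨t.downSub.trans
    (OrderIso.trans ?_ (PTree.latNode _).symm)⟩⟩
  refine PiNAP.piCongrIso e fun c => ?_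
  rw [e.symm_apply_apply]
  exact (hs c).some.withTopCongr

end NAP

/-! ### Classes of finite products and of posets with an added greatest element -/

namespace Incidence

variable {G : GoodFamily}

theorem nonempty_iso_of_cls_eq {Q R : Type} [PartialOrder Q] [PartialOrder R] [hQ : InFam G Q]
    [hR : InFam G R] (h : cls G Q = cls G R) : Nonempty (Q ≃o R) := by
  obtain ⟨l, ⟨e⟩⟩ := hQ.exists_iso
  obtain ⟨m, ⟨f⟩⟩ := hR.exists_iso
  rw [cls_eq_mk e, cls_eq_mk f] at h
  obtain ⟨g⟩ := Quotient.exact h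
  exact ⟨e.trans (g.trans f.symm)⟩

/-- Membership in the family and the product formula come from the same induction, which splits off
the first factor; the formula needs the membership in order to be stated. -/
theorem exists_cls_pi : ∀ {n : ℕ} (Q : Fin n → Type) [∀ i, PartialOrder (Q i)]
    [∀ i, InFam G (Q i)], ∃ _ : InFam G (∀ i, Q i), cls G (∀ i, Q i) = ∏ i, cls G (Q i)
  | 0, Q, _, _ => by
    have h : InFam G (∀ i, Q i) := ⟨[], ⟨uniqueIso (R := PUnit) (fun i => i.elim0) PUnit.unit⟩⟩
    exact ⟨h, by rw [cls_one _ fun i => i.elim0, Finset.univ_eq_empty, Finset.prod_empty]⟩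
  | n + 1, Q, _, _ => by
    obtain ⟨_, h⟩ := exists_cls_pi fun i => Q i.succ
    have e : (∀ i, Q i) ≃o Q 0 × ∀ i : Fin n, Q i.succ := (Fin.consOrderIso Q).symm
    have h' := InFam.of_iso (G := G) e
    exact ⟨h', by rw [cls_eq e, cls_prod, h, Fin.prod_univ_succ]⟩

section WithTop

variable {Q : Type} [PartialOrder Q]

/-- Together with `iciCoeIso` this is the local content of the cocycle identity: adding a greatest
element leaves the interval below an old element unchanged and adds a greatest element to the
interval above it. -/
noncomputable def iicCoeIso (a : Q) : Set.Iic a ≃o Set.Iic (a : WithTop Q) :=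
  RelIso.ofSurjective
    (OrderEmbedding.ofMapLEIff
      (fun b => (⟨WithTop.some b.1, Set.mem_Iic.2 (WithTop.coe_le_coe.2 (Set.mem_Iic.1 b.2))⟩ :
        Set.Iic (a : WithTop Q)))
      fun b c => (WithTop.coe_le_coe : ((b.1 : WithTop Q) ≤ (c.1 : WithTop Q)) ↔ b.1 ≤ c.1))
    (by
      rintro ⟨b, hb⟩
      induction b using WithTop.recTopCoe with
      | top => exact absurd (Set.mem_Iic.1 hb) (by simp)
      | coe b => exact ⟨⟨b, WithTop.coe_le_coe.1 hb⟩, rfl⟩)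

noncomputable def iciCoeIso (a : Q) : WithTop (Set.Ici a) ≃o Set.Ici (a : WithTop Q) :=
  RelIso.ofSurjective
    (OrderEmbedding.ofMapLEIff
      (fun b => (⟨b.map Subtype.val, Set.mem_Ici.2 (by
        induction b using WithTop.recTopCoe with
        | top => exact le_top
        | coe b => exact WithTop.coe_le_coe.2 b.2)⟩ : Set.Ici (a : WithTop Q)))
      fun b c => WithTop.map_le_iff Subtype.val Iff.rfl)
    (by
      rintro ⟨b, hb⟩
      induction b using WithTop.recTopCoe with
      | top => exact ⟨⊤, rfl⟩
      | coe b => exact ⟨WithTop.some ⟨b, WithTop.coe_le_coe.1 hb⟩, rfl⟩)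

end WithTop

end Incidence

/-! ### Isomorphism classes in the NAP family correspond to rooted trees -/

section NAPFamily

open Incidence

instance instInFamLat (t : PTree) : InFam napFamily t.Lat :=
  InFam.of_iso (G := napFamily) (PiNAP.iicIso (PiNAP.ofTree t.toNAP)).symm

/-- This is `PTree.latNode` for a single branch. It lets the operation on trees `t ↦ B(r, t)` be
defined on posets. -/
noncomputable def PTree.withTopLat (t : PTree) :
    WithTop t.Lat ≃o (PTree.node 1 fun _ => t).Lat :=
  (OrderIso.funUnique (Fin 1) (WithTop t.Lat)).symm.trans (PTree.latNode fun _ => t).symm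

instance instInFamWithTopLat (t : PTree) : InFam napFamily (WithTop t.Lat) :=
  InFam.of_iso (G := napFamily) t.withTopLat

namespace RTree

/-- The class of the interval `[0̂, t]`. -/
noncomputable def cls : RTree → Cls napFamily :=
  Quotient.lift (fun t : PTree => Incidence.cls napFamily t.Lat) fun s t h => by
    obtain ⟨e, he⟩ := PTree.Equivalent.exists_equiv h
    exact cls_eq (PiNAP.downCongr e he)

theorem cls_mk (t : PTree) : cls (mk t) = Incidence.cls napFamily t.Lat := rfl

theorem F_mk (K : Type*) [CommRing K] (t : PTree) :
    F K (mk t) = Incidence.F napFamily K t.Lat :=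
  F_eq napFamily K (PiNAP.iicIso (PiNAP.ofTree t.toNAP))

theorem F_eq_Fbasis (K : Type*) [CommRing K] (t : RTree) :
    F K t = Fbasis napFamily K (cls t) := by
  induction t using Quotient.inductionOn with
  | h t => exact F_mk K t

/-- Equal classes give isomorphic intervals, and `PTree.equivalent_of_lat` recovers the tree from
its interval. -/
theorem cls_injective : Function.Injective cls := by
  intro s t h
  induction s using Quotient.inductionOn with
  | h s =>
  induction t using Quotient.inductionOn with
  | h t => exact Quotient.sound (PTree.equivalent_of_lat (nonempty_iso_of_cls_eq h).some)

theorem node_singleton_mk (t : PTree) : node {mk t} = mk (PTree.node 1 fun _ => t) :=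
  node_eq fun _ : Fin 1 => t

theorem cls_node_singleton (t : PTree) :
    cls (node {mk t}) = Incidence.cls napFamily (WithTop t.Lat) := by
  rw [node_singleton_mk, cls_mk]
  exact cls_eq t.withTopLat.symm

/-- The interval of `B(r, t_1, …, t_k)` is a product whose factors are the intervals of the trees
`B(r, t_i)`. Thus merging the roots of trees corresponds to multiplying their classes. -/
theorem cls_node (s : Multiset RTree) : cls (node s) = (s.map fun t => cls (node {t})).prod := by
  obtain ⟨-, n, f, -, rfl⟩ := exists_rep s
  obtain ⟨_, h⟩ := exists_cls_pi (G := napFamily) fun i => WithTop (f i).Lat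
  rw [node_eq, cls_mk, cls_eq (PTree.latNode f), h, Multiset.map_map]
  simp only [Function.comp_def, cls_node_singleton]
  rfl

theorem exists_node (t : RTree) : ∃ s, node s = t := by
  induction t using ind with
  | h s _ => exact ⟨s, rfl⟩

theorem node_injective : Function.Injective node := by
  intro s t h
  obtain ⟨-, n, f, -, rfl⟩ := exists_rep s
  obtain ⟨-, m, g, -, rfl⟩ := exists_rep t
  rw [node_eq, node_eq] at h
  obtain ⟨σ, hσ⟩ : PTree.Equivalent (PTree.node n f) (PTree.node m g) := Quotient.exact h
  have h1 : (fun i => mk (f i)) = fun i => mk (g (σ i)) := funext fun i => Quotient.sound (hσ i)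
  rw [h1, ← Multiset.map_univ_val_equiv σ, Multiset.map_map]
  rfl

/-- A product of intervals is the interval of a single tree: by `cls_node`, the classes of `node s'`
and `node s` multiply to that of `node (s' + s)`. The empty product is the class of the one-vertex
tree `node 0`. -/
theorem cls_surjective : Function.Surjective cls := by
  intro c
  induction c using Cls.ind with
  | h l =>
  induction l with
  | nil =>
    refine ⟨node 0, ?_⟩
    rw [cls_node, Multiset.map_zero, Multiset.prod_zero]
    exact (cls_prd (G := napFamily) []).symm
  | cons a l ih =>
    obtain ⟨t, ht⟩ := ih
    obtain ⟨s, rfl⟩ := exists_node t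
    obtain ⟨p, ⟨e⟩⟩ := a.2.exists_lat
    have h : cls (mk p) = Incidence.cls napFamily (Prd napFamily.P [a]) :=
      cls_eq (e.symm.trans ((PiNAP.iicIso (PiNAP.ofTree a.2)).symm.trans
        (OrderIso.prodComm.trans punitProdIso).symm))
    obtain ⟨s', hs'⟩ := exists_node (mk p)
    refine ⟨node (s' + s), ?_⟩
    rw [cls_node, Multiset.map_add, Multiset.prod_add, ← cls_node, ← cls_node, hs', ht, h,
      cls_prd, cls_prd, cls_prd]
    rfl

end RTree

theorem exists_iso_lat (Q : Type) [PartialOrder Q] [InFam napFamily Q] :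
    ∃ t : PTree, Nonempty (Q ≃o t.Lat) := by
  obtain ⟨t, ht⟩ := RTree.cls_surjective (Incidence.cls napFamily Q)
  induction t using Quotient.inductionOn with
  | h t => exact ⟨t, nonempty_iso_of_cls_eq ht.symm⟩

/-- A product in the family is the interval of one tree `t`, so adding a greatest element gives the
interval of `B(r, t)`. This makes `HNAP.L` meaningful on every basis element. -/
instance instInFamWithTop (Q : Type) [PartialOrder Q] [InFam napFamily Q] :
    InFam napFamily (WithTop Q) := by
  obtain ⟨t, ⟨e⟩⟩ := exists_iso_lat Q
  exact InFam.of_iso (G := napFamily) e.withTopCongr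

/-! ### The cocycle on the incidence Hopf algebra -/

namespace HNAP

variable (K : Type*) [CommRing K]

/-- The linear map that adds a new greatest element to a poset. -/
noncomputable def L : HNAP K →ₗ[K] HNAP K :=
  (Fbasis napFamily K).constr K fun c => F napFamily K (WithTop (Prd napFamily.P c.out))

/-- The representative chosen in `L` does not matter, because an isomorphism of posets extends to
the added greatest elements. -/
theorem L_F (Q : Type) [PartialOrder Q] [InFam napFamily Q] :
    L K (F napFamily K Q) = F napFamily K (WithTop Q) := by
  refine ((Fbasis napFamily K).constr_basis K _ _).trans (F_eq napFamily K ?_)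
  exact (nonempty_iso_of_cls_eq (cls_out (Incidence.cls napFamily Q))).some.withTopCongr

theorem L_rtree (t : RTree) : L K (RTree.F K t) = RTree.F K (RTree.node {t}) := by
  induction t using Quotient.inductionOn with
  | h t =>
    change L K (RTree.F K (RTree.mk t)) = RTree.F K (RTree.node {RTree.mk t})
    rw [RTree.node_singleton_mk, RTree.F_mk, RTree.F_mk, L_F]
    exact F_eq napFamily K t.withTopLat

variable {K}

/-- Every basis element is some `F_[t]`, not merely a product of such elements. This is what makes a
linear map determined by its values on the `F_[t]`. -/
theorem linearMap_ext {M : Type*} [AddCommGroup M] [Module K M] {f g : HNAP K →ₗ[K] M}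
    (h : ∀ t, f (RTree.F K t) = g (RTree.F K t)) : f = g :=
  (Fbasis napFamily K).ext fun c => by
    obtain ⟨t, rfl⟩ := RTree.cls_surjective c
    rw [← RTree.F_eq_Fbasis, h]

theorem isCocycle_L : IsCocycle (L K) := by
  suffices h : Coalgebra.comul ∘ₗ L K = (TensorProduct.mk K (HNAP K) (HNAP K)).flip 1 ∘ₗ L K +
      (L K).lTensor (HNAP K) ∘ₗ Coalgebra.comul from fun x => LinearMap.congr_fun h x
  refine linearMap_ext fun t => ?_
  induction t using Quotient.inductionOn with
  | h t =>
  change Coalgebra.comul (L K (RTree.F K (RTree.mk t))) = L K (RTree.F K (RTree.mk t)) ⊗ₜ[K] 1 +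
    (L K).lTensor (HNAP K) (Coalgebra.comul (RTree.F K (RTree.mk t)))
  rw [RTree.F_mk]
  have : Finite t.Lat := InFam.finite napFamily _
  have : Fintype t.Lat := Fintype.ofFinite _
  let : Fintype (WithTop t.Lat) := inferInstanceAs (Fintype (Option t.Lat))
  rw [L_F, comul_F, comul_F, map_sum]
  -- The sum over the enlarged poset splits into its new greatest element, which contributes `L x ⊗
  -- 1`, and the old elements, which contribute the terms of the old coproduct with `L` applied on
  -- the right.
  refine (Fintype.sum_option _).trans (congrArg₂ _ ?_ (Finset.sum_congr rfl fun x _ => ?_))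
  · change F napFamily K (Set.Iic (⊤ : WithTop t.Lat)) ⊗ₜ[K]
      F napFamily K (Set.Ici (⊤ : WithTop t.Lat)) = _
    rw [F_eq napFamily K (iicTop (Q := WithTop t.Lat)),
      F_one napFamily K (⟨⊤, Set.mem_Ici.2 le_rfl⟩ : Set.Ici (⊤ : WithTop t.Lat))
        (hQ := (subsingleton_ici_iff _).2 rfl)]
  · change F napFamily K (Set.Iic (x : WithTop t.Lat)) ⊗ₜ[K]
      F napFamily K (Set.Ici (x : WithTop t.Lat)) = _
    rw [LinearMap.lTensor_tmul, L_F, F_eq napFamily K (iicCoeIso x),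
      F_eq napFamily K (iciCoeIso x)]

end HNAP

end NAPFamily

/-! ### Compatibility of bialgebra morphisms with antipodes -/

section Antipode

variable {K A B : Type*} [CommRing K] [CommRing A] [CommRing B] [HopfAlgebra K A] [HopfAlgebra K B]

/-- Morphisms of bialgebras commute with the antipodes. -/
theorem map_antipode (φ : A →ₐc[K] B) (x : A) :
    φ (HopfAlgebra.antipode K x) = HopfAlgebra.antipode K (φ x) := by
  have h1 := LinearMap.algHom_comp_convMul_distrib (φ : A →ₐ[K] B)
    (WithConv.toConv (HopfAlgebra.antipode K (A := A))) (WithConv.toConv LinearMap.id)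
  have h2 := LinearMap.convMul_comp_coalgHom_distrib
    (WithConv.toConv LinearMap.id) (WithConv.toConv (HopfAlgebra.antipode K (A := B)))
    (φ : A →ₗc[K] B)
  rw [LinearMap.antipode_mul_id] at h1
  rw [LinearMap.id_mul_antipode] at h2
  -- In the convolution algebra of maps from `A` to `B`, the composite of the antipode of `A` with
  -- `φ` is a left inverse of `φ`, and the composite of `φ` with the antipode of `B` is a right
  -- inverse. The two inverses coincide.
  have h1' : WithConv.toConv ((φ : A →ₐ[K] B).toLinearMap ∘ₗ HopfAlgebra.antipode K) *
      WithConv.toConv (φ : A →ₐ[K] B).toLinearMap = 1 := by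
    refine WithConv.ext (h1.symm.trans (LinearMap.ext fun x => ?_))
    exact (φ : A →ₐ[K] B).commutes _
  have h2' : WithConv.toConv (φ : A →ₐ[K] B).toLinearMap *
      WithConv.toConv (HopfAlgebra.antipode K ∘ₗ (φ : A →ₐ[K] B).toLinearMap) = 1 := by
    refine WithConv.ext (h2.symm.trans (LinearMap.ext fun x => ?_))
    exact congrArg (algebraMap K B) (CoalgHomClass.counit_comp_apply φ x)
  exact LinearMap.congr_fun (congrArg WithConv.ofConv (left_inv_eq_right_inv h1' h2')) x

end Antipode

/-! ### Universality of the Connes–Kreimer Hopf algebra -/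

section Universal

variable {K : Type*} [CommRing K]

/-- Applying `id ⊗ ε` to the cocycle identity gives `L x ⊗ 1` on the left and the same term plus
`(id ⊗ εL)(Δ x)` on the right, so the latter vanishes. Applying `ε ⊗ id` to it leaves `ε (L x) = 0`.
-/
theorem IsCocycle.counit {H : Type*} [CommRing H] [HopfAlgebra K H] {L : H →ₗ[K] H}
    (hL : IsCocycle L) (x : H) : Coalgebra.counit (R := K) (L x) = 0 := by
  have h1 := congrArg ((Coalgebra.counit (R := K) (A := H)).lTensor H) (hL x)
  rw [Coalgebra.lTensor_counit_comul, map_add, LinearMap.lTensor_tmul, Bialgebra.counit_one,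
    left_eq_add, ← LinearMap.lTensor_comp_apply] at h1
  have h2 := congrArg ((Coalgebra.counit (R := K) (A := H)).rTensor K) h1
  rw [map_zero, ← LinearMap.comp_apply, LinearMap.rTensor_comp_lTensor,
    ← LinearMap.lTensor_comp_rTensor, LinearMap.comp_apply, Coalgebra.rTensor_counit_comul,
    LinearMap.lTensor_tmul] at h2
  simpa using congrArg (TensorProduct.lid K K) h2

namespace CK

variable {H : Type*} [CommRing H] [HopfAlgebra K H] (L : H →ₗ[K] H)

/-- The values on the trees of the morphism determined by a linear map. -/
noncomputable def inducedPTree : PTree → H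
  | PTree.node _ f => L (∏ i, inducedPTree (f i))

theorem inducedPTree_eq : ∀ {s t : PTree}, PTree.Equivalent s t →
    inducedPTree L s = inducedPTree L t
  | PTree.node n f, PTree.node m g, ⟨σ, h⟩ => by
    rw [inducedPTree, inducedPTree,
      Fintype.prod_equiv σ _ (fun j => inducedPTree L (g j)) fun i => inducedPTree_eq (h i)]

/-- The morphism of algebras that intertwines `B⁺` and a linear map. -/
noncomputable def inducedAlgHom : CK K →ₐ[K] H :=
  lift K (Quotient.lift (inducedPTree L) fun _ _ h => inducedPTree_eq L h)

theorem inducedAlgHom_Bplus (x : CK K) :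
    inducedAlgHom L (Bplus K x) = L (inducedAlgHom L x) := by
  have : (inducedAlgHom L).toLinearMap ∘ₗ Bplus K = L ∘ₗ (inducedAlgHom L).toLinearMap := by
    refine linearMap_ext fun s => ?_
    obtain ⟨-, n, f, -, rfl⟩ := RTree.exists_rep s
    change inducedAlgHom L (Bplus K _) = L (inducedAlgHom L _)
    rw [Bplus_forest, forest_rep, map_prod, RTree.node_eq]
    have hX : ∀ t : PTree, inducedAlgHom L (X K (RTree.mk t)) = inducedPTree L t :=
      fun t => lift_X K _ _
    simp only [hX]
    exact inducedPTree.eq_1 L n f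
  exact LinearMap.congr_fun this x

variable {L}

/-- The morphism of bialgebras that intertwines `B⁺` and a 1-cocycle. -/
noncomputable def inducedBialgHom (hL : IsCocycle L) : CK K →ₐc[K] H :=
  BialgHom.ofAlgHom (inducedAlgHom L)
    (by
      refine algHom_ext fun x _ => ?_
      change Coalgebra.counit (R := K) (inducedAlgHom L (Bplus K x)) = counitHom K (Bplus K x)
      rw [inducedAlgHom_Bplus, hL.counit, counitHom_Bplus])
    (by
      -- Compatibility with the coproducts passes from `x` to `B⁺ x`: both `B⁺` and `L` satisfy the
      -- cocycle identity, and the morphism intertwines them.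
      refine algHom_ext fun x hx => ?_
      have hx' : Algebra.TensorProduct.map (inducedAlgHom L) (inducedAlgHom L) (comulHom K x) =
        Coalgebra.comul (R := K) (inducedAlgHom L x) := hx
      have h1 : ∀ y : CK K ⊗[K] CK K,
          Algebra.TensorProduct.map (inducedAlgHom L) (inducedAlgHom L) (idB K y) =
            L.lTensor H (Algebra.TensorProduct.map (inducedAlgHom L) (inducedAlgHom L) y) := by
        intro y
        induction y using TensorProduct.induction_on with
        | zero => simp
        | add y z hy hz => simp only [map_add, hy, hz]
        | tmul a b =>
          rw [idB_tmul, Algebra.TensorProduct.map_tmul, Algebra.TensorProduct.map_tmul,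
            inducedAlgHom_Bplus, LinearMap.lTensor_tmul]
      change Algebra.TensorProduct.map (inducedAlgHom L) (inducedAlgHom L)
          (comulHom K (Bplus K x)) = Coalgebra.comul (R := K) (inducedAlgHom L (Bplus K x))
      rw [comulHom_Bplus, map_add, h1, hx', inducedAlgHom_Bplus, hL,
        Algebra.TensorProduct.map_tmul, inducedAlgHom_Bplus, map_one])

theorem inducedBialgHom_Bplus (hL : IsCocycle L) (x : CK K) :
    inducedBialgHom hL (Bplus K x) = L (inducedBialgHom hL x) := inducedAlgHom_Bplus L x

/-- A morphism of bialgebras out of the Connes–Kreimer Hopf algebra that intertwines `B⁺` and a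
linear map is unique. -/
theorem bialgHom_ext {φ ψ : CK K →ₐc[K] H} (hφ : ∀ x, φ (Bplus K x) = L (φ x))
    (hψ : ∀ x, ψ (Bplus K x) = L (ψ x)) : φ = ψ := by
  have h : (φ : CK K →ₐ[K] H) = ψ := algHom_ext fun x hx => by
    change φ x = ψ x at hx
    change φ (Bplus K x) = ψ (Bplus K x)
    rw [hφ, hψ, hx]
  exact BialgHom.ext fun x => AlgHom.congr_fun h x

theorem isCocycle_Bplus : IsCocycle (Bplus K) := comulHom_Bplus

end CK

end Universal

/-- The morphisms here are bialgebra morphisms between Hopf algebras; they respect the antipodes by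
`map_antipode`, so this is universality among Hopf algebras. -/
theorem CK.isUniversalCocycle_Bplus {K : Type u} [CommRing K] :
    IsUniversalCocycle.{w} (CK.Bplus K) :=
  ⟨CK.isCocycle_Bplus, fun _ _ _ _ hL =>
    ⟨CK.inducedBialgHom hL, CK.inducedBialgHom_Bplus hL,
      fun _ hψ => CK.bialgHom_ext hψ (CK.inducedBialgHom_Bplus hL)⟩⟩

/-- Universality is transported along isomorphisms. -/
theorem IsUniversalCocycle.of_equiv.{v, v'} {K : Type u} [CommRing K] {H : Type v}
    {H₁ : Type v'} [CommRing H] [HopfAlgebra K H] [CommRing H₁] [HopfAlgebra K H₁] {L : H →ₗ[K] H}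
    {L₁ : H₁ →ₗ[K] H₁} (h : IsUniversalCocycle.{w} L) (hL₁ : IsCocycle L₁) (e : H₁ ≃ₐc[K] H)
    (he : ∀ x, e (L₁ x) = L (e x)) : IsUniversalCocycle.{w} L₁ := by
  refine ⟨hL₁, fun H' _ _ L' hL' => ?_⟩
  obtain ⟨φ, hφ, huniq⟩ := h.2 H' L' hL'
  refine ⟨φ.comp (e : H₁ →ₐc[K] H), fun x => ?_, fun ψ hψ => ?_⟩
  · change φ (e (L₁ x)) = L' (φ (e x))
    rw [he, hφ]
  · have h1 : ψ.comp (e.symm : H →ₐc[K] H₁) = φ := huniq _ fun x => by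
      change ψ (e.symm (L x)) = L' (ψ (e.symm x))
      rw [← hψ, ← e.symm_apply_apply (L₁ (e.symm x)), he, e.apply_symm_apply]
    rw [← h1]
    refine BialgHom.ext fun x => ?_
    change ψ x = ψ (e.symm (e x))
    rw [e.symm_apply_apply]

/-! ### The isomorphism between the two Hopf algebras -/

namespace HNAP

open Incidence

variable (K : Type*) [CommRing K]

theorem F_node (s : Multiset RTree) :
    RTree.F K (RTree.node s) = (s.map fun t => RTree.F K (RTree.node {t})).prod := by
  let f : Cls napFamily →* HNAP K :=
    { toFun := Fbasis napFamily K, map_one' := Fbasis_one _ _, map_mul' := Fbasis_mul _ _ }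
  simp only [RTree.F_eq_Fbasis]
  rw [RTree.cls_node]
  change f _ = (s.map fun t => f _).prod
  rw [map_multiset_prod, Multiset.map_map]
  rfl

/-- The morphism `ℋ_R → H_NAP` that intertwines the 1-cocycles. -/
noncomputable def ofCK : CK K →ₐc[K] HNAP K := CK.inducedBialgHom isCocycle_L

variable {K}

theorem ofCK_Bplus (x : CK K) : ofCK K (CK.Bplus K x) = L K (ofCK K x) :=
  CK.inducedBialgHom_Bplus isCocycle_L x

/-- A generator `t` goes to `F` of `B(r, t)`, not to `F_[t]`: writing `t` as `B⁺` of a forest `s`,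
induction sends `s` to `F_[t]`, and `L` turns this into `F` of `B(r, t)`. Multiplicativity and
`F_node` then give all forests. -/
theorem ofCK_forest (s : Multiset RTree) :
    ofCK K (CK.forest K s) = RTree.F K (RTree.node s) := by
  have h1 : ∀ s : Multiset RTree,
      (∀ t ∈ s, ofCK K (CK.X K t) = RTree.F K (RTree.node {t})) →
        ofCK K (CK.forest K s) = RTree.F K (RTree.node s) := fun s hs => by
    rw [CK.forest, map_multiset_prod, Multiset.map_map, F_node]
    exact congrArg _ (Multiset.map_congr rfl hs)
  have h2 : ∀ t, ofCK K (CK.X K t) = RTree.F K (RTree.node {t}) := fun t => by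
    induction t using RTree.ind with
    | h s ih =>
      rw [← CK.Bplus_forest, ofCK_Bplus, h1 s ih, L_rtree]
  exact h1 s fun t _ => h2 t

/-- The forests form a basis of one side and the `F` of isomorphism classes a basis of the other. By
`ofCK_forest` the morphism carries basis to basis along `s ↦ RTree.cls (RTree.node s)`, which is
bijective because both `RTree.node` and `RTree.cls` are. -/
theorem ofCK_bijective : Function.Bijective (ofCK K) := by
  have hb : Function.Bijective fun s => RTree.cls (RTree.node s) := by
    refine ⟨fun s t h => ?_, fun c => ?_⟩
    · exact RTree.node_injective (RTree.cls_injective h)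
    · obtain ⟨t, rfl⟩ := RTree.cls_surjective c
      obtain ⟨s, rfl⟩ := RTree.exists_node t
      exact ⟨s, rfl⟩
  let e : CK K ≃ₗ[K] HNAP K := (CK.basis K).equiv (Fbasis napFamily K) (Equiv.ofBijective _ hb)
  have he : (ofCK K : CK K →ₗ[K] HNAP K) = e := CK.linearMap_ext fun s => by
    change ofCK K (CK.forest K s) = e (CK.forest K s)
    rw [ofCK_forest, ← CK.basis_apply, Module.Basis.equiv_apply, RTree.F_eq_Fbasis]
    rfl
  have he' : ⇑(ofCK K) = e := funext fun x => LinearMap.congr_fun he x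
  rw [he']
  exact e.bijective

/-- The isomorphism `H_NAP ≃ ℋ_R`. -/
noncomputable def equivCK : HNAP K ≃ₐc[K] CK K :=
  (BialgEquiv.ofBijective (ofCK K) ofCK_bijective).symm

theorem equivCK_ofCK (x : CK K) : equivCK (ofCK K x) = x :=
  (BialgEquiv.ofBijective (ofCK K) ofCK_bijective).symm_apply_apply x

theorem equivCK_L (x : HNAP K) : equivCK (L K x) = CK.Bplus K (equivCK x) := by
  obtain ⟨y, rfl⟩ := ofCK_bijective.2 x
  rw [equivCK_ofCK, ← ofCK_Bplus, equivCK_ofCK]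

/-- Composing `ψ` with `ofCK K` gives an endomorphism of the Connes–Kreimer algebra that commutes
with `B⁺`; it is the identity by uniqueness, so `ψ` inverts `ofCK K`. -/
theorem bialgHom_eq_equivCK {ψ : HNAP K →ₐc[K] CK K}
    (hψ : ∀ x, ψ (L K x) = CK.Bplus K (ψ x)) (x : HNAP K) : ψ x = equivCK x := by
  obtain ⟨y, rfl⟩ := ofCK_bijective.2 x
  have h : ψ.comp (ofCK K) = BialgHom.id K (CK K) :=
    CK.bialgHom_ext (L := CK.Bplus K) (fun z => by
      change ψ (ofCK K _) = CK.Bplus K (ψ (ofCK K z))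
      rw [ofCK_Bplus, hψ]) fun _ => rfl
  rw [equivCK_ofCK]
  exact DFunLike.congr_fun h y

end HNAP

theorem mainTheorem2 (K : Type u) [Field K] :
    ∃ L : HNAP K →ₗ[K] HNAP K,
      (∀ t : RTree, L (RTree.F K t) = RTree.F K (RTree.node {t})) ∧
      (∀ L' : HNAP K →ₗ[K] HNAP K,
        (∀ t : RTree, L' (RTree.F K t) = RTree.F K (RTree.node {t})) → L' = L) ∧
      IsUniversalCocycle.{w} L ∧
      IsUniversalCocycle.{w} (CK.Bplus K) ∧
      ∃ φ : HNAP K ≃ₐc[K] CK K,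
        (∀ x : HNAP K, φ (L x) = CK.Bplus K (φ x)) ∧
        (∀ ψ : HNAP K →ₐc[K] CK K,
          (∀ x : HNAP K, ψ (L x) = CK.Bplus K (ψ x)) → ∀ x : HNAP K, ψ x = φ x) ∧
        (∀ x : HNAP K, φ (HopfAlgebra.antipode K x) = HopfAlgebra.antipode K (φ x)) ∧
        ∀ s : Multiset RTree, φ (RTree.F K (RTree.node s)) = CK.forest K s := by
  refine ⟨HNAP.L K, HNAP.L_rtree K, fun L' hL' => HNAP.linearMap_ext fun t => ?_,
    CK.isUniversalCocycle_Bplus.of_equiv HNAP.isCocycle_L HNAP.equivCK HNAP.equivCK_L,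
    CK.isUniversalCocycle_Bplus, HNAP.equivCK, HNAP.equivCK_L, fun ψ => HNAP.bialgHom_eq_equivCK,
    map_antipode (HNAP.equivCK (K := K)).toBialgHom, fun s => ?_⟩
  · rw [hL', HNAP.L_rtree]
  · rw [← HNAP.ofCK_forest, HNAP.equivCK_ofCK]
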